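/- Let $\mathbb{K}\subset\mathbb{R}$ be compact, $\nu\in\mathcal{P}(\mathbb{K})$ a Borel probability measure, $M\ge 1$, $b\in\mathbb{R}^M$, and let $\mathcal{U}_1,\dots,\mathcal{U}_M\subset\mathbb{R}$ be compact convex sets containing $0$. Put $T=\prod_{i=1}^M\{b_i-u:u\in\mathcal{U}_i\}\subset\mathbb{R}^M$ and, for finite signed measures $\mu$ on $\mathbb{K}$, $(\mathcal{A}\mu)_i=\int_{\mathbb{K}}x^i\,\mu(dx)$, $i=1,\dots,M$, with $\|\mathcal{A}\|=\sup\{\langle\mathcal{A}\mu,v\rangle:\|\mu\|_{\mathsf{TV}}=1,\ \|v\|_2=1,\ v\in\mathbb{R}^M\}$ and $\mathcal{A}^*z(x)=\sum_{i=1}^M z_ix^i$. Let $\mathrm{KL}(\mu\|\nu)$ be the relative entropy with logarithm to base $2$, $J^\star=\min\{\mathrm{KL}(\mu\|\nu):\mu\in\mathcal{P}(\mathbb{K}),\ \mathcal{A}\mu\in T\}$, and $$F(z)=-\max_{x\in T}\langle x,z\rangle+\min_{\mu\in\mathcal{P}(\mathbb{K})}\{\mathrm{KL}(\mu\|\nu)+\langle\mathcal{A}\mu,z\rangle\},$$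 $$F_\eta(z)=-\max_{x\in T}\Big\{\langle x,z\rangle-\frac{\eta_1}{2}\|x\|_2^2\Big\}+\min_{\mu\in\mathcal{P}(\mathbb{K})}\{\mathrm{KL}(\mu\|\nu)+\langle\mathcal{A}\mu,z\rangle\}-\frac{\eta_2}{2}\|z\|_2^2$$ for $z\in\mathbb{R}^M$ and $\eta=(\eta_1,\eta_2)\in\mathbb{R}_{>0}^2$. Assume there is a Slater point: $\mu_0\in\mathcal{P}(\mathbb{K})$ with $\mathcal{A}\mu_0\in T$, $\delta:=\inf_{v\in T^c}\|\mathcal{A}\mu_0-v\|_2>0$, and $0<C:=\mathrm{KL}(\mu_0\|\nu)<\infty$. Let $D:=\frac12\max_{x\in T}\|x\|_2^2$ and, for $\varepsilon>0$, $\eta_1(\varepsilon)=\frac{\varepsilon}{4D}$, $\eta_2(\varepsilon)=\frac{\varepsilon\delta^2}{2C^2}$, $L(\eta)=\frac1{\eta_1}+\|\mathcal{A}\|^2+\eta_2$, $$S(\varepsilon)=\sqrt{\frac{8DC^2}{\varepsilon^2\delta^2}+\frac{2\|\mathcal{A}\|^2C^2}{\varepsilon\delta^2}+1},\qquad N_1(\varepsilon)=2S(\varepsilon)\ln\frac{10(\varepsilon+2C)}{\varepsilon},$$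 $$N_2(\varepsilon)=2S(\varepsilon)\ln\left(\frac{C}{\varepsilon\delta(2-\sqrt3)}\sqrt{4\Big(\frac{4D}{\varepsilon}+\|\mathcal{A}\|^2+\frac{\varepsilon\delta^2}{2C^2}\Big)\Big(C+\frac{\varepsilon}{2}\Big)}\right),$$ and $N(\varepsilon)=\lceil\max\{N_1(\varepsilon),N_2(\varepsilon)\}\rceil$. Consider the fast gradient method with $\eta=(\eta_1(\varepsilon),\eta_2(\varepsilon))$ started at $w_0=y_0=0\in\mathbb{R}^M$: $$y_{k+1}=w_k+\frac{1}{L(\eta)}\nabla F_\eta(w_k),\qquad w_{k+1}=y_{k+1}+\frac{\sqrt{L(\eta)}-\sqrt{\eta_2}}{\sqrt{L(\eta)}+\sqrt{\eta_2}}(y_{k+1}-y_k).$$ Then the minimum $J^\star$ is finite and attained, and for every $\varepsilon>0$ the function $F_\eta$ is differentiable and, with $k=N(\varepsilon)$, the dual iterate $\hat z:=y_k$ and the probability measure $\hat\mu(B):=\int_B2^{-\mathcal{A}^*\hat z}\,d\nu\big/\int_{\mathbb{K}}2^{-\mathcal{A}^*\hat z}\,d\nu$ satisfy $\mathrm{KL}(\hat\mu\|\nu)<\infty$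 and (i) $0\le J^\star-F(\hat z)\le\varepsilon$; (ii) $|\mathrm{KL}(\hat\mu\|\nu)-J^\star|\le 2(1+2\sqrt3)\varepsilon$; (iii) $d(\mathcal{A}\hat\mu,T)\le\frac{2\varepsilon\delta}{C}$, where $d(x,T)=\min_{v\in T}\|x-v\|_2$. Moreover, for fixed data, $N(\varepsilon)=O\big(\frac1\varepsilon\log\frac1\varepsilon\big)$ as $\varepsilon\to0$. -/

import Mathlib

open MeasureTheory Filter Topology Asymptotics
open scoped ENNReal Gradient

noncomputable section

namespace MaxEnt

variable {K : Set ℝ} {M : ℕ}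

/-- Relative entropy `D(μ‖ν)` in bits (logarithm to base 2), for probability measures; it is `∞`
if `μ` is not absolutely continuous with respect to `ν`. `InformationTheory.klDiv` is the relative
entropy with the natural logarithm. -/
def relEntropy (μ ν : Measure K) : ℝ≥0∞ :=
  InformationTheory.klDiv μ ν / ENNReal.ofReal (Real.log 2)

/-- The moment operator `𝒜` on finite signed measures on `K`, `(𝒜 μ)ᵢ = ∫ xⁱ dμ` for
`i = 1, …, M` (the index set `Fin M` starts at `0`, hence the exponent `i + 1`). -/
def momentOp (M : ℕ) (μ : SignedMeasure K) : EuclideanSpace ℝ (Fin M) :=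
  WithLp.toLp 2 fun i => ∫ᵛ x, (x : ℝ) ^ ((i : ℕ) + 1) ∂<•μ

/-- The moment vector `𝒜 μ` of a (nonnegative) measure `μ` on `K`. -/
def moments (M : ℕ) (μ : Measure K) : EuclideanSpace ℝ (Fin M) :=
  WithLp.toLp 2 fun i => ∫ x, (x : ℝ) ^ ((i : ℕ) + 1) ∂μ

/-- `moments` is the restriction of `momentOp` to finite nonnegative measures. -/
theorem momentOp_toSignedMeasure (μ : Measure K) [IsFiniteMeasure μ] :
    momentOp M μ.toSignedMeasure = moments M μ := by
  simp [momentOp, moments]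

/-- The operator norm `‖𝒜‖ = sup {⟨𝒜 μ, y⟩ : ‖μ‖_TV = 1, ‖y‖₂ = 1}`, over finite signed measures
`μ` on `K` and vectors `y ∈ ℝᴹ`. -/
def opNorm (K : Set ℝ) (M : ℕ) : ℝ :=
  sSup {r : ℝ | ∃ (μ : SignedMeasure K) (y : EuclideanSpace ℝ (Fin M)),
    μ.totalVariation Set.univ = 1 ∧ ‖y‖ = 1 ∧ r = inner ℝ (momentOp M μ) y}

/-- The adjoint of the moment operator, `(𝒜* z)(x) = ∑ᵢ zᵢ xⁱ`. -/
def adjointOp (z : EuclideanSpace ℝ (Fin M)) (x : K) : ℝ :=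
  ∑ i : Fin M, z i * (x : ℝ) ^ ((i : ℕ) + 1)

/-- The uncertainty set `T`, the product over `i` of the sets `{yᵢ - u : u ∈ Uᵢ}`. -/
def uncertaintySet (y : Fin M → ℝ) (U : Fin M → Set ℝ) : Set (EuclideanSpace ℝ (Fin M)) :=
  {t | ∀ i, ∃ u ∈ U i, t i = y i - u}

/-- The optimal value `J⋆` of the problem: minimize `D(μ‖ν)` over `μ ∈ 𝒫(K)` with `𝒜 μ ∈ T`. -/
def optimalValue (ν : Measure K) (T : Set (EuclideanSpace ℝ (Fin M))) : ℝ≥0∞ :=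
  ⨅ (μ : ProbabilityMeasure K) (_ : moments M (μ : Measure K) ∈ T), relEntropy (μ : Measure K) ν

/-- The support function `σ_T(z) = max_{x ∈ T} ⟨x, z⟩` of a compact nonempty set `T`. -/
def supportFun (T : Set (EuclideanSpace ℝ (Fin M))) (z : EuclideanSpace ℝ (Fin M)) : ℝ :=
  sSup ((fun x => inner ℝ x z) '' T)

/-- The smoothed support function `max_{x ∈ T} {⟨x, z⟩ - (η₁/2) ‖x‖²}`. -/
def smoothedSupportFun (T : Set (EuclideanSpace ℝ (Fin M))) (η₁ : ℝ)
    (z : EuclideanSpace ℝ (Fin M)) : ℝ :=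
  sSup ((fun x => inner ℝ x z - η₁ / 2 * ‖x‖ ^ 2) '' T)

/-- The value `min_{μ ∈ 𝒫(K)} {D(μ‖ν) + ⟨𝒜 μ, z⟩}`. Measures with `D(μ‖ν) = ∞` are left out: they
do not affect the minimum. -/
def innerMin (ν : Measure K) (z : EuclideanSpace ℝ (Fin M)) : ℝ :=
  sInf {r : ℝ | ∃ μ : ProbabilityMeasure K, relEntropy (μ : Measure K) ν ≠ ⊤ ∧
    r = (relEntropy (μ : Measure K) ν).toReal + inner ℝ (moments M (μ : Measure K)) z}

/-- The dual function `F`. -/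
def dualFun (ν : Measure K) (T : Set (EuclideanSpace ℝ (Fin M)))
    (z : EuclideanSpace ℝ (Fin M)) : ℝ :=
  -supportFun T z + innerMin ν z

/-- The doubly smoothed dual function `F_η`, with `η = (η₁, η₂)`. -/
def smoothedDualFun (ν : Measure K) (T : Set (EuclideanSpace ℝ (Fin M))) (η₁ η₂ : ℝ)
    (z : EuclideanSpace ℝ (Fin M)) : ℝ :=
  -smoothedSupportFun T η₁ z + innerMin ν z - η₂ / 2 * ‖z‖ ^ 2

/-- The constant `L(η) = 1/η₁ + ‖𝒜‖² + η₂`. -/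
def lipConst (K : Set ℝ) (M : ℕ) (η₁ η₂ : ℝ) : ℝ :=
  1 / η₁ + opNorm K M ^ 2 + η₂

/-- The fast gradient method for maximizing `G`, with step `1/L` and strong concavity parameter
`η₂`, started at `w₀ = y₀ = 0`. The value at `k` is the pair `(y_k, w_k)`. -/
def fastGradient (G : EuclideanSpace ℝ (Fin M) → ℝ) (L η₂ : ℝ) :
    ℕ → EuclideanSpace ℝ (Fin M) × EuclideanSpace ℝ (Fin M)
  | 0 => (0, 0)
  | k + 1 =>
    let y := (fastGradient G L η₂ k).1
    let w := (fastGradient G L η₂ k).2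
    let y' := w + (1 / L) • ∇ G w
    (y', y' + ((√L - √η₂) / (√L + √η₂)) • (y' - y))

/-- The Gibbs measure `μ̂(B) = (∫_B 2^{-𝒜* z} dν) / (∫_K 2^{-𝒜* z} dν)`. -/
def gibbs (ν : Measure K) (z : EuclideanSpace ℝ (Fin M)) : Measure K :=
  ν.withDensity fun x =>
    ENNReal.ofReal ((2 : ℝ) ^ (-adjointOp z x) / ∫ x', (2 : ℝ) ^ (-adjointOp z x') ∂ν)

/-- The Slater margin `δ`, the distance from `𝒜 μ₀` to the complement of `T`. -/
def slaterMargin (μ₀ : Measure K) (T : Set (EuclideanSpace ℝ (Fin M))) : ℝ :=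
  Metric.infDist (moments M μ₀) Tᶜ

/-- The constant `D = (1/2) max_{x ∈ T} ‖x‖²`. -/
def proxBound (T : Set (EuclideanSpace ℝ (Fin M))) : ℝ :=
  1 / 2 * sSup ((fun x => ‖x‖ ^ 2) '' T)

/-- The smoothing parameter `η₁(ε) = ε / (4 D)`. -/
def eta₁ (D ε : ℝ) : ℝ := ε / (4 * D)

/-- The smoothing parameter `η₂(ε) = ε δ² / (2 C²)`. -/
def eta₂ (C δ ε : ℝ) : ℝ := ε * δ ^ 2 / (2 * C ^ 2)

/-- The iteration bound `N₁(ε)`; `a` stands for `‖𝒜‖`. -/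
def N₁ (C D δ a ε : ℝ) : ℝ :=
  2 * √(8 * D * C ^ 2 / (ε ^ 2 * δ ^ 2) + 2 * a ^ 2 * C ^ 2 / (ε * δ ^ 2) + 1) *
    Real.log (10 * (ε + 2 * C) / ε)

/-- The iteration bound `N₂(ε)`; `a` stands for `‖𝒜‖`. -/
def N₂ (C D δ a ε : ℝ) : ℝ :=
  2 * √(8 * D * C ^ 2 / (ε ^ 2 * δ ^ 2) + 2 * a ^ 2 * C ^ 2 / (ε * δ ^ 2) + 1) *
    Real.log (C / (ε * δ * (2 - √3)) *
      √(4 * (4 * D / ε + a ^ 2 + ε * δ ^ 2 / (2 * C ^ 2)) * (C + ε / 2)))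

/-- The number of iterations `N(ε) = ⌈max {N₁(ε), N₂(ε)}⌉`. -/
def iterations (C D δ a ε : ℝ) : ℕ :=
  ⌈max (N₁ C D δ a ε) (N₂ C D δ a ε)⌉₊

end MaxEnt

end

/-! By the Gibbs variational principle the inner minimum over `μ` equals `-logPartition ν z` and is
attained at `gibbs ν z`, so the dual problem is finite-dimensional and concave. A ball of radius `δ`
around the Slater moments inside `T` gives `F z ≤ C - δ‖z‖` (`dualFun_le_sub_norm`). This coercivity
yields a dual maximizer `z₀` with `δ‖z₀‖ ≤ C`. First-order optimality there says that the Gibbs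
moments lie in `T` and attain the support function, which is strong duality (`exists_dual_optimal`).

For the algorithm, `-F_η` lies between quadratic models of curvature `η₂` and `L(η)`. The upper
curvature comes from projection onto `T` (`exists_smoothedSupportFun_bounds`) and from Hoeffding's
lemma (`quadraticBounds_logPartition`). A Lyapunov argument then contracts the gap by `1 - √(η₂/L)`
per step (`fastGradient_gap_le`).

The bound `N₁` makes the smoothed gap at most `ε/200`, which controls the dual value and the norm of
the iterate. The bound `N₂` makes the gradient at most `εδ/(5C)`. That gradient is `p z - 𝒜μ̂ + η₂
z` with `p z ∈ T`, so a small gradient makes the residual `p z - 𝒜μ̂` small. The residual bounds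
both infeasibility and the duality gap (`gibbs_estimates`). -/

namespace MaxEnt

/-! ### Convex functions between two quadratic models, and one accelerated step. -/

section Optimization

variable {E : Type*} [NormedAddCommGroup E] [InnerProductSpace ℝ E]

/-- `f` lies between the quadratic models with curvatures `m` and `L` at every point, where `g`
plays the role of the gradient. -/
def QuadraticBounds (f : E → ℝ) (g : E → E) (m L : ℝ) : Prop :=
  ∀ w y, m / 2 * ‖y - w‖ ^ 2 ≤ f y - f w - inner ℝ (g w) (y - w) ∧
    f y - f w - inner ℝ (g w) (y - w) ≤ L / 2 * ‖y - w‖ ^ 2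

theorem QuadraticBounds.add {f₁ f₂ : E → ℝ} {g₁ g₂ : E → E} {m₁ m₂ L₁ L₂ : ℝ}
    (h₁ : QuadraticBounds f₁ g₁ m₁ L₁) (h₂ : QuadraticBounds f₂ g₂ m₂ L₂) :
    QuadraticBounds (fun x => f₁ x + f₂ x) (fun x => g₁ x + g₂ x) (m₁ + m₂) (L₁ + L₂) := by
  intro w y
  have a := h₁ w y
  have b := h₂ w y
  simp only [inner_add_left]
  constructor <;> linarith [a.1, a.2, b.1, b.2]

theorem quadraticBounds_norm_sq (c : ℝ) :
    QuadraticBounds (fun x : E => c / 2 * ‖x‖ ^ 2) (fun x => c • x) c c := by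
  intro w y
  have h : c / 2 * ‖y‖ ^ 2 - c / 2 * ‖w‖ ^ 2 - inner ℝ (c • w) (y - w) = c / 2 * ‖y - w‖ ^ 2 := by
    rw [norm_sub_sq_real, real_inner_smul_left, inner_sub_right, real_inner_self_eq_norm_sq,
      real_inner_comm]
    ring
  exact ⟨h.ge, h.le⟩

variable {f : E → ℝ} {g : E → E} {m L : ℝ}

/-- The two models squeeze the linearization error to `O(‖y - w‖²)`, so the formal gradient is the
true one. -/
theorem QuadraticBounds.hasGradientAt [CompleteSpace E] (h : QuadraticBounds f g m L) (w : E) :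
    HasGradientAt f (g w) w := by
  rw [hasGradientAt_iff_isLittleO]
  have h1 : (fun y => f y - f w - inner ℝ (g w) (y - w)) =O[𝓝 w] fun y => ‖y - w‖ ^ 2 := by
    refine IsBigO.of_bound (|m| / 2 + |L| / 2) (Eventually.of_forall fun y => ?_)
    have a := h w y
    have p := sq_nonneg ‖y - w‖
    rw [Real.norm_eq_abs, Real.norm_eq_abs, abs_of_nonneg p, abs_le]
    constructor <;> nlinarith [neg_abs_le m, le_abs_self L, abs_nonneg m, abs_nonneg L]
  refine h1.trans_isLittleO ?_
  have h2 : Tendsto (fun y : E => ‖y - w‖) (𝓝 w) (𝓝 0) := by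
    have : Continuous fun y : E => ‖y - w‖ := by fun_prop
    simpa using this.tendsto w
  have h3 : (fun y : E => ‖y - w‖ * ‖y - w‖) =o[𝓝 w] fun y => (1 : ℝ) * ‖y - w‖ :=
    ((isLittleO_one_iff ℝ).2 h2).mul_isBigO (isBigO_refl _ _)
  simp only [one_mul] at h3
  simpa only [sq] using h3.of_norm_right

theorem QuadraticBounds.step_le (h : QuadraticBounds f g m L) (hL : 0 < L) (w : E) :
    f (w - (1 / L) • g w) ≤ f w - 1 / (2 * L) * ‖g w‖ ^ 2 := by
  have a := (h w (w - (1 / L) • g w)).2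
  have e : w - (1 / L) • g w - w = -((1 / L) • g w) := by abel
  rw [e, inner_neg_right, real_inner_smul_right, real_inner_self_eq_norm_sq, norm_neg, norm_smul,
    Real.norm_of_nonneg (by positivity)] at a
  have : L / 2 * (1 / L * ‖g w‖) ^ 2 = 1 / (2 * L) * ‖g w‖ ^ 2 := by field_simp
  have h2 : 1 / L * ‖g w‖ ^ 2 = 2 * (1 / (2 * L) * ‖g w‖ ^ 2) := by field_simp
  linarith

/-- A gradient step of length `1 / L` cannot descend below the minimum. This turns a small gap in
value into a small gradient. -/
theorem QuadraticBounds.norm_sq_le (h : QuadraticBounds f g m L) (hL : 0 < L) {x : E}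
    (hx : ∀ y, f x ≤ f y) (w : E) : ‖g w‖ ^ 2 ≤ 2 * L * (f w - f x) := by
  have a := (hx _).trans (h.step_le hL w)
  have : ‖g w‖ ^ 2 = 2 * L * (1 / (2 * L) * ‖g w‖ ^ 2) := by field_simp
  rw [this]
  gcongr
  linarith

theorem QuadraticBounds.gradient_eq_zero (h : QuadraticBounds f g m L) (hL : 0 < L) {x : E}
    (hx : ∀ y, f x ≤ f y) : g x = 0 := by
  have := h.norm_sq_le hL hx x
  simpa using this

theorem QuadraticBounds.dist_sq_le (h : QuadraticBounds f g m L) (hL : 0 < L) {x : E}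
    (hx : ∀ y, f x ≤ f y) (w : E) : m / 2 * ‖w - x‖ ^ 2 ≤ f w - f x := by
  have := (h x w).1
  simpa [h.gradient_eq_zero hL hx] using this

theorem norm_sq_combo_le {θ : ℝ} (hθ : 0 ≤ θ) (hθ1 : θ ≤ 1) (a b : E) :
    ‖(1 - θ) • a + θ • b‖ ^ 2 ≤ (1 - θ) * ‖a‖ ^ 2 + θ * ‖b‖ ^ 2 := by
  have key : (1 - θ) * ‖a‖ ^ 2 + θ * ‖b‖ ^ 2 - ‖(1 - θ) • a + θ • b‖ ^ 2 =
      θ * (1 - θ) * ‖a - b‖ ^ 2 := by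
    rw [norm_add_sq_real, norm_sub_sq_real, norm_smul, norm_smul, real_inner_smul_left,
      real_inner_smul_right, mul_pow, mul_pow, Real.norm_eq_abs, Real.norm_eq_abs, sq_abs, sq_abs]
    ring
  have : 0 ≤ θ * (1 - θ) * ‖a - b‖ ^ 2 := mul_nonneg (mul_nonneg hθ (by linarith)) (sq_nonneg _)
  linarith

/-- The potential adds to the gap the distance from an auxiliary point `v` to `z`. The proof
combines descent at `w` with the lower model at `z`, weight `θ`, and at `x`, weight `1 - θ`. The
comparison point `z` need not be a minimizer. -/
theorem fast_gradient_lyapunov (h : QuadraticBounds f g m L) (hm : 0 < m) (hL : 0 < L)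
    {θ : ℝ} (hθ : 0 < θ) (hθ1 : θ ≤ 1) (hθL : θ ^ 2 * L = m) {x v w : E} (z : E)
    (hw : (1 + θ) • w = x + θ • v) :
    f (w - (1 / L) • g w) - f z + m / 2 * ‖(1 - θ) • v + θ • w - (θ / m) • g w - z‖ ^ 2 ≤
      (1 - θ) * (f x - f z + m / 2 * ‖v - z‖ ^ 2) := by
  have h1 := h.step_le hL w
  have h2 := (h w z).1
  have h3 := (h w x).1
  have h3' : 0 ≤ m / 2 * ‖x - w‖ ^ 2 := by positivity
  set G := g w
  set a := v - z with ha
  set b := w - z with hb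
  have e1 : (1 - θ) • v + θ • w - (θ / m) • G - z = ((1 - θ) • a + θ • b) - (θ / m) • G := by
    rw [ha, hb]; module
  have e2 : x - w = θ • (b - a) := by
    have : x = (1 + θ) • w - θ • v := by rw [hw]; abel
    rw [this, ha, hb]; module
  have e3 : z - w = -b := by rw [hb]; abel
  have hcvx := norm_sq_combo_le hθ.le hθ1 a b
  rw [e1, norm_sub_sq_real, real_inner_smul_right, norm_smul, mul_pow, inner_add_left,
    real_inner_smul_left, real_inner_smul_left, Real.norm_of_nonneg (by positivity)]
  rw [e3, inner_neg_right, norm_neg, real_inner_comm] at h2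
  rw [e2, real_inner_smul_right, inner_sub_right, real_inner_comm b, real_inner_comm a] at h3
  -- The relation `θ² L = m` makes the squared gradient produced by moving `v` cancel the descent of
  -- the gradient step.
  have e4 : m / 2 * ((θ / m) ^ 2 * ‖G‖ ^ 2) = 1 / (2 * L) * ‖G‖ ^ 2 := by
    rw [← hθL]; field_simp
  have e5 : m / 2 * (2 * (θ / m * ((1 - θ) * inner ℝ a G + θ * inner ℝ b G))) =
      θ * ((1 - θ) * inner ℝ a G + θ * inner ℝ b G) := by field_simp
  have h4 := mul_le_mul_of_nonneg_left hcvx (by positivity : 0 ≤ m / 2)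
  have h5 : θ * (m / 2 * ‖b‖ ^ 2) ≤ θ * (f z - f w - -inner ℝ b G) :=
    mul_le_mul_of_nonneg_left h2 hθ.le
  rw [e2] at h3'
  have h6 : 0 ≤ (1 - θ) * (f x - f w - θ * (inner ℝ b G - inner ℝ a G)) :=
    mul_nonneg (by linarith) (h3'.trans h3)
  rw [mul_add, mul_sub, e4, e5]
  linarith

end Optimization

/-! ### Linear rate of the fast gradient method. -/

section FastGradient

variable {M : ℕ} {G : EuclideanSpace ℝ (Fin M) → ℝ}
  {g : EuclideanSpace ℝ (Fin M) → EuclideanSpace ℝ (Fin M)} {m L : ℝ}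

/-- Linear convergence of the fast gradient method for strongly concave smooth functions. -/
theorem fastGradient_gap_le (h : QuadraticBounds (fun z => -G z) g m L) (hm : 0 < m) (hmL : m ≤ L)
    (z : EuclideanSpace ℝ (Fin M)) (k : ℕ) :
    G z - G (fastGradient G L m k).1 ≤
      (1 - √(m / L)) ^ k * (G z - G 0 + m / 2 * ‖z‖ ^ 2) := by
  have hL : 0 < L := hm.trans_le hmL
  set θ := √(m / L) with hθdef
  have hθ : 0 < θ := Real.sqrt_pos.2 (by positivity)
  have hθ1 : θ ≤ 1 := by
    exact Real.sqrt_le_one.mpr ((div_le_one hL).2 hmL)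
  have hθL : θ ^ 2 * L = m := by
    rw [hθdef, Real.sq_sqrt (by positivity)]
    field_simp
  have hβ : (√L - √m) / (√L + √m) = (1 - θ) / (1 + θ) := by
    have : √m = θ * √L := by
      rw [hθdef, Real.sqrt_div hm.le]
      have := Real.sqrt_pos.2 hL
      field_simp
    have := Real.sqrt_pos.2 hL
    rw [‹√m = θ * √L›]
    field_simp
  have hgrad : ∀ w, ∇ G w = -g w := fun w => by
    have := (h.hasGradientAt w).hasFDerivAt.neg
    have h2 : HasGradientAt G (-g w) w := by
      rw [hasGradientAt_iff_hasFDerivAt]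
      simpa [Function.comp_def, Pi.neg_def] using this
    exact h2.gradient
  -- The method stores only `y` and `w`; the Lyapunov point `v` is recovered from the coupling `(1 +
  -- θ) w = y + θ v`, which the momentum coefficient `(1 - θ) / (1 + θ)` preserves.
  have key : ∀ k, ∃ v : EuclideanSpace ℝ (Fin M),
      (1 + θ) • (fastGradient G L m k).2 = (fastGradient G L m k).1 + θ • v ∧
      G z - G (fastGradient G L m k).1 + m / 2 * ‖v - z‖ ^ 2 ≤
        (1 - θ) ^ k * (G z - G 0 + m / 2 * ‖z‖ ^ 2) := by
    intro k
    induction k with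
    | zero => exact ⟨0, by simp [fastGradient], by simp [fastGradient]⟩
    | succ k ih =>
      obtain ⟨v, hv, hV⟩ := ih
      set x := (fastGradient G L m k).1 with hx
      set w := (fastGradient G L m k).2 with hw
      have hx' : (fastGradient G L m (k + 1)).1 = w - (1 / L) • g w := by
        simp only [fastGradient, ← hw, hgrad]; module
      have hw' : (fastGradient G L m (k + 1)).2 =
          (w - (1 / L) • g w) + ((1 - θ) / (1 + θ)) • (w - (1 / L) • g w - x) := by
        simp only [fastGradient, ← hw, ← hx, hgrad, hβ]; module
      have hly := fast_gradient_lyapunov h hm hL hθ hθ1 hθL z hv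
      refine ⟨(1 - θ) • v + θ • w - (θ / m) • g w, ?_, ?_⟩
      · rw [hx', hw']
        have e : θ • v = (1 + θ) • w - x := by rw [hv]; abel
        have e2 : θ • ((1 - θ) • v + θ • w - (θ / m) • g w) =
            (1 - θ) • ((1 + θ) • w - x) + (θ ^ 2) • w - (1 / L) • g w := by
          rw [← e, ← hθL]
          have : θ * (θ / (θ ^ 2 * L)) = 1 / L := by field_simp
          rw [smul_sub, smul_smul, this]
          module
        rw [e2]
        have h1 : (1 + θ) * ((1 - θ) / (1 + θ)) = 1 - θ := by field_simp
        rw [smul_add, smul_smul, h1]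
        module
      · rw [hx', pow_succ']
        have := mul_le_mul_of_nonneg_left hV (by linarith : 0 ≤ 1 - θ)
        simp only [sub_neg_eq_add] at hly
        calc _ = -G (w - (1 / L) • g w) + G z +
              m / 2 * ‖(1 - θ) • v + θ • w - (θ / m) • g w - z‖ ^ 2 := by ring
          _ ≤ _ := hly
          _ = (1 - θ) * (G z - G x + m / 2 * ‖v - z‖ ^ 2) := by ring
          _ ≤ _ := this
          _ = _ := by ring
  obtain ⟨v, -, hV⟩ := key k
  have : 0 ≤ m / 2 * ‖v - z‖ ^ 2 := by positivity
  linarith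

end FastGradient

/-! ### Support functions, their smoothing, and geometry of the uncertainty set. -/

section Support

variable {M : ℕ} {T : Set (EuclideanSpace ℝ (Fin M))}

theorem bddAbove_inner_image (hT : IsCompact T) (z : EuclideanSpace ℝ (Fin M)) :
    BddAbove ((fun x => inner ℝ x z) '' T) :=
  hT.bddAbove_image (by fun_prop)

theorem inner_le_supportFun (hT : IsCompact T) {x : EuclideanSpace ℝ (Fin M)} (hx : x ∈ T)
    (z : EuclideanSpace ℝ (Fin M)) : inner ℝ x z ≤ supportFun T z :=
  le_csSup (bddAbove_inner_image hT z) ⟨x, hx, rfl⟩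

theorem supportFun_le (hne : T.Nonempty) {z : EuclideanSpace ℝ (Fin M)} {r : ℝ}
    (h : ∀ x ∈ T, inner ℝ x z ≤ r) : supportFun T z ≤ r :=
  csSup_le (hne.image _) (by rintro _ ⟨x, hx, rfl⟩; exact h x hx)

theorem continuous_supportFun (hT : IsCompact T) : Continuous (supportFun T) :=
  hT.continuous_sSup (f := fun z x => inner ℝ x z) (by fun_prop)

theorem supportFun_zero (hne : T.Nonempty) : supportFun T 0 = 0 := by
  unfold supportFun
  simp [hne.image_const]

theorem supportFun_combo_le (hT : IsCompact T) (hne : T.Nonempty) {t : ℝ} (ht : 0 ≤ t) (ht1 : t ≤ 1)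
    (z w : EuclideanSpace ℝ (Fin M)) :
    supportFun T (z + t • (w - z)) ≤ (1 - t) * supportFun T z + t * supportFun T w := by
  refine supportFun_le hne fun x hx => ?_
  have h1 := mul_le_mul_of_nonneg_left (inner_le_supportFun hT hx z) (by linarith : 0 ≤ 1 - t)
  have h2 := mul_le_mul_of_nonneg_left (inner_le_supportFun hT hx w) ht
  rw [inner_add_right, real_inner_smul_right, inner_sub_right]
  linarith

theorem exists_projection (hT : IsCompact T) (hc : Convex ℝ T) (hne : T.Nonempty)
    (u : EuclideanSpace ℝ (Fin M)) : ∃ p ∈ T, ∀ x ∈ T, inner ℝ (u - p) (x - p) ≤ 0 := by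
  obtain ⟨p, hp, h⟩ := exists_norm_eq_iInf_of_complete_convex hne hT.isComplete hc u
  exact ⟨p, hp, (norm_eq_iInf_iff_real_inner_le_zero hc hp).1 h⟩

/-- Separation: if `p` is the projection of `g` onto `T`, testing the hypothesis in direction `g -
p` forces `g = p`. -/
theorem mem_of_inner_le_supportFun (hT : IsCompact T) (hc : Convex ℝ T) (hne : T.Nonempty)
    {g : EuclideanSpace ℝ (Fin M)} (h : ∀ w, inner ℝ g w ≤ supportFun T w) : g ∈ T := by
  obtain ⟨p, hp, hproj⟩ := exists_projection hT hc hne g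
  have h1 : supportFun T (g - p) ≤ inner ℝ p (g - p) := supportFun_le hne fun x hx => by
    have := hproj x hx
    rw [real_inner_comm, inner_sub_left] at this
    linarith
  have h2 := (h (g - p)).trans h1
  have h3 : ‖g - p‖ ^ 2 ≤ 0 := by
    rw [← real_inner_self_eq_norm_sq, inner_sub_left]
    linarith
  have h4 : ‖g - p‖ = 0 := pow_eq_zero_iff two_ne_zero |>.1 (le_antisymm h3 (sq_nonneg _))
  rwa [sub_eq_zero.1 (norm_eq_zero.1 h4)]

/-- First-order optimality for minimizing `supportFun T + Λ` with `Λ` differentiable. -/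
theorem optimality_of_isMin (hT : IsCompact T) (hc : Convex ℝ T) (hne : T.Nonempty)
    {Λ : EuclideanSpace ℝ (Fin M) → ℝ} {g : EuclideanSpace ℝ (Fin M) → EuclideanSpace ℝ (Fin M)}
    {m L : ℝ} (hΛ : QuadraticBounds Λ g m L) {z : EuclideanSpace ℝ (Fin M)}
    (hz : ∀ w, supportFun T z + Λ z ≤ supportFun T w + Λ w) :
    -g z ∈ T ∧ supportFun T z = inner ℝ (-g z) z := by
  -- Minimality is compared along the segment from `z` to `w`, divided by `t`, and `t → 0` removes
  -- the quadratic error of `Λ`.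
  have sub : ∀ w, inner ℝ (-g z) (w - z) ≤ supportFun T w - supportFun T z := by
    intro w
    have h1 : ∀ t ∈ Set.Ioo (0 : ℝ) 1, inner ℝ (-g z) (w - z) ≤
        supportFun T w - supportFun T z + t * (L / 2 * ‖w - z‖ ^ 2) := by
      intro t ht
      have a := hz (z + t • (w - z))
      have b := supportFun_combo_le hT hne ht.1.le ht.2.le z w
      have c := (hΛ z (z + t • (w - z))).2
      rw [add_sub_cancel_left, real_inner_smul_right, norm_smul, mul_pow,
        Real.norm_of_nonneg ht.1.le] at c
      rw [inner_neg_left]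
      refine le_of_mul_le_mul_left ?_ ht.1
      linarith
    have h2 : Tendsto (fun t : ℝ => supportFun T w - supportFun T z + t * (L / 2 * ‖w - z‖ ^ 2))
        (𝓝[>] 0) (𝓝 (supportFun T w - supportFun T z + 0 * (L / 2 * ‖w - z‖ ^ 2))) := by
      refine Tendsto.mono_left (Continuous.tendsto ?_ 0) nhdsWithin_le_nhds
      fun_prop
    rw [zero_mul, add_zero] at h2
    exact ge_of_tendsto h2 (eventually_of_mem (Ioo_mem_nhdsGT one_pos) h1)
  have h0 := sub 0
  rw [zero_sub, inner_neg_right, supportFun_zero hne] at h0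
  -- Subadditivity turns the subgradient inequality at `z + w` into a bound by the support function
  -- at every `w`.
  have hmem : -g z ∈ T := by
    refine mem_of_inner_le_supportFun hT hc hne fun w => ?_
    have a := sub (z + w)
    have b : supportFun T (z + w) ≤ supportFun T z + supportFun T w := supportFun_le hne
      fun x hx => by
        rw [inner_add_right]
        exact add_le_add (inner_le_supportFun hT hx z) (inner_le_supportFun hT hx w)
    rw [add_sub_cancel_left] at a
    linarith
  exact ⟨hmem, le_antisymm (by linarith) (inner_le_supportFun hT hmem z)⟩

theorem le_smoothedSupportFun (hT : IsCompact T) {η : ℝ} {x : EuclideanSpace ℝ (Fin M)}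
    (hx : x ∈ T) (z : EuclideanSpace ℝ (Fin M)) :
    inner ℝ x z - η / 2 * ‖x‖ ^ 2 ≤ smoothedSupportFun T η z :=
  le_csSup (hT.bddAbove_image (f := fun x => inner ℝ x z - η / 2 * ‖x‖ ^ 2) (by fun_prop))
    ⟨x, hx, rfl⟩

theorem smoothedSupportFun_le (hne : T.Nonempty) {η : ℝ} {z : EuclideanSpace ℝ (Fin M)} {r : ℝ}
    (h : ∀ x ∈ T, inner ℝ x z - η / 2 * ‖x‖ ^ 2 ≤ r) : smoothedSupportFun T η z ≤ r :=
  csSup_le (hne.image _) (by rintro _ ⟨x, hx, rfl⟩; exact h x hx)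

theorem smoothedSupportFun_le_supportFun (hT : IsCompact T) (hne : T.Nonempty) {η : ℝ}
    (hη : 0 ≤ η) (z : EuclideanSpace ℝ (Fin M)) :
    smoothedSupportFun T η z ≤ supportFun T z :=
  smoothedSupportFun_le hne fun x hx => by
    have := inner_le_supportFun hT hx z
    have : 0 ≤ η / 2 * ‖x‖ ^ 2 := by positivity
    linarith

theorem supportFun_le_smoothedSupportFun (hT : IsCompact T) (hne : T.Nonempty) {η D : ℝ}
    (hη : 0 ≤ η) (hD : ∀ x ∈ T, ‖x‖ ^ 2 ≤ 2 * D) (z : EuclideanSpace ℝ (Fin M)) :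
    supportFun T z ≤ smoothedSupportFun T η z + η * D :=
  supportFun_le hne fun x hx => by
    have h1 := le_smoothedSupportFun (η := η) hT hx z
    have h2 := mul_le_mul_of_nonneg_left (hD x hx) (by positivity : 0 ≤ η / 2)
    linarith

/-- Completing the square, the maximizer is the projection of `z / η` onto `T`. The projection
inequality supplies the extra `η/2 ‖x - p z‖²` that Young's inequality spends to get curvature
`1/η`. -/
theorem exists_smoothedSupportFun_bounds (hT : IsCompact T) (hc : Convex ℝ T) (hne : T.Nonempty)
    {η : ℝ} (hη : 0 < η) :
    ∃ p : EuclideanSpace ℝ (Fin M) → EuclideanSpace ℝ (Fin M), (∀ z, p z ∈ T) ∧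
      (∀ z, smoothedSupportFun T η z = inner ℝ (p z) z - η / 2 * ‖p z‖ ^ 2) ∧
      QuadraticBounds (smoothedSupportFun T η) p 0 (1 / η) := by
  choose p hp hproj using fun z => exists_projection hT hc hne ((1 / η) • z)
  have hgap : ∀ z, ∀ x ∈ T, inner ℝ x z - η / 2 * ‖x‖ ^ 2 + η / 2 * ‖x - p z‖ ^ 2 ≤
      inner ℝ (p z) z - η / 2 * ‖p z‖ ^ 2 := by
    intro z x hx
    have h := mul_le_mul_of_nonneg_left (hproj z x hx) hη.le
    have e1 : η * inner ℝ ((1 / η) • z - p z) (x - p z) =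
        inner ℝ (z - η • p z) (x - p z) := by
      rw [← real_inner_smul_left, smul_sub, smul_smul, mul_one_div_cancel hη.ne', one_smul]
    rw [e1, mul_zero, inner_sub_left, inner_sub_right, inner_sub_right, real_inner_smul_left,
      real_inner_smul_left, real_inner_self_eq_norm_sq, real_inner_comm, real_inner_comm (p z) z,
      real_inner_comm x (p z)] at h
    rw [norm_sub_sq_real]
    linarith
  have hval : ∀ z, smoothedSupportFun T η z = inner ℝ (p z) z - η / 2 * ‖p z‖ ^ 2 := fun z =>
    le_antisymm (smoothedSupportFun_le hne fun x hx => by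
      have := hgap z x hx
      have : 0 ≤ η / 2 * ‖x - p z‖ ^ 2 := by positivity
      linarith) (le_smoothedSupportFun hT (hp z) z)
  refine ⟨p, hp, hval, fun z w => ⟨?_, ?_⟩⟩
  · have h1 := le_smoothedSupportFun (η := η) hT (hp z) w
    rw [hval z, inner_sub_right, zero_div, zero_mul]
    linarith
  · suffices smoothedSupportFun T η w ≤ smoothedSupportFun T η z + inner ℝ (p z) (w - z) +
        1 / η / 2 * ‖w - z‖ ^ 2 by linarith
    refine smoothedSupportFun_le hne fun x hx => ?_
    have h1 := hgap z x hx
    have h2 : inner ℝ x w = inner ℝ x z + inner ℝ (x - p z) (w - z) + inner ℝ (p z) (w - z) := by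
      simp only [inner_sub_left, inner_sub_right]; ring
    have h3 := real_inner_le_norm (x - p z) (w - z)
    have h4 : ‖x - p z‖ * ‖w - z‖ ≤ η / 2 * ‖x - p z‖ ^ 2 + 1 / η / 2 * ‖w - z‖ ^ 2 := by
      have h5 : 0 ≤ 1 / (2 * η) * (η * ‖x - p z‖ - ‖w - z‖) ^ 2 := by positivity
      have h6 : 1 / (2 * η) * (η * ‖x - p z‖ - ‖w - z‖) ^ 2 =
          η / 2 * ‖x - p z‖ ^ 2 + 1 / η / 2 * ‖w - z‖ ^ 2 - ‖x - p z‖ * ‖w - z‖ := by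
        field_simp; ring
      linarith
    rw [hval z]
    linarith

theorem norm_sq_le_proxBound (hT : IsCompact T) {x : EuclideanSpace ℝ (Fin M)} (hx : x ∈ T) :
    ‖x‖ ^ 2 ≤ 2 * proxBound T := by
  have : ‖x‖ ^ 2 ≤ sSup ((fun x : EuclideanSpace ℝ (Fin M) => ‖x‖ ^ 2) '' T) :=
    le_csSup (hT.bddAbove_image (by fun_prop)) ⟨x, hx, rfl⟩
  unfold proxBound
  linarith

theorem closedBall_subset_of_infDist_compl (hT : IsClosed T) {c : EuclideanSpace ℝ (Fin M)} {δ : ℝ}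
    (hδ : δ = Metric.infDist c Tᶜ) (hδpos : 0 < δ) : Metric.closedBall c δ ⊆ T := by
  have h : Metric.ball c δ ⊆ T := fun x hx => by
    by_contra hxT
    have := Metric.infDist_le_dist_of_mem (x := c) (s := Tᶜ) hxT
    rw [← hδ, dist_comm] at this
    exact absurd (Metric.mem_ball.1 hx) (not_lt.2 this)
  rw [← closure_ball c hδpos.ne']
  exact hT.closure_subset_iff.2 h

theorem le_supportFun_of_closedBall_subset (hT : IsCompact T) {c : EuclideanSpace ℝ (Fin M)} {δ : ℝ}
    (hδ : 0 ≤ δ) (hball : Metric.closedBall c δ ⊆ T) (z : EuclideanSpace ℝ (Fin M)) :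
    inner ℝ c z + δ * ‖z‖ ≤ supportFun T z := by
  -- This is the farthest point of the ball in direction `z`; for `z = 0` division by zero returns
  -- the centre.
  have hmem : c + (δ / ‖z‖) • z ∈ T := hball (by
    rw [Metric.mem_closedBall, dist_self_add_left, norm_smul, norm_div, norm_norm,
      Real.norm_of_nonneg hδ]
    rcases eq_or_ne ‖z‖ 0 with h | h
    · simpa [h] using hδ
    · rw [div_mul_cancel₀ _ h])
  refine le_of_eq_of_le ?_ (inner_le_supportFun hT hmem z)
  rw [inner_add_left, real_inner_smul_left, real_inner_self_eq_norm_sq]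
  rcases eq_or_ne ‖z‖ 0 with h | h
  · simp [h]
  · field_simp

/-- Otherwise `T` would be `{0}`, which contains no ball of positive radius once the space is
nontrivial. Nontriviality follows from `δ > 0`: the distance to an empty complement is `0` by
convention. -/
theorem proxBound_pos (hT : IsCompact T) {c : EuclideanSpace ℝ (Fin M)} {δ : ℝ}
    (hδ : δ = Metric.infDist c Tᶜ) (hδpos : 0 < δ) : 0 < proxBound T := by
  have hball := closedBall_subset_of_infDist_compl hT.isClosed hδ hδpos
  obtain ⟨v, hv⟩ : Tᶜ.Nonempty := by
    by_contra h
    rw [Set.not_nonempty_iff_eq_empty.1 h, Metric.infDist_empty] at hδ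
    exact hδpos.ne' hδ
  have hvc : v - c ≠ 0 := fun h => hv (by
    rw [sub_eq_zero.1 h]; exact hball (Metric.mem_closedBall_self hδpos.le))
  have hσ := le_supportFun_of_closedBall_subset hT hδpos.le hball
  by_contra hD
  have hzero : ∀ x ∈ T, x = 0 := fun x hx => by
    have := norm_sq_le_proxBound hT hx
    have h0 : ‖x‖ ^ 2 = 0 := le_antisymm (by linarith) (sq_nonneg _)
    simpa using h0
  have hcT : c ∈ T := hball (Metric.mem_closedBall_self hδpos.le)
  have h1 := hσ (v - c)
  have h2 : supportFun T (v - c) ≤ 0 := supportFun_le ⟨c, hcT⟩ fun x hx => by simp [hzero x hx]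
  rw [hzero c hcT, inner_zero_left, zero_add] at h1
  rw [hzero c hcT] at h2 hvc
  have := mul_pos hδpos (norm_pos_iff.2 hvc)
  linarith

theorem convex_uncertaintySet {b : Fin M → ℝ} {U : Fin M → Set ℝ} (hU : ∀ i, Convex ℝ (U i)) :
    Convex ℝ (uncertaintySet b U) := by
  intro x hx x' hx' s t hs ht hst i
  obtain ⟨u, hu, h⟩ := hx i
  obtain ⟨u', hu', h'⟩ := hx' i
  refine ⟨s • u + t • u', hU i hu hu' hs ht hst, ?_⟩
  simp only [PiLp.add_apply, PiLp.smul_apply, smul_eq_mul, h, h']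
  linear_combination b i * hst

theorem isCompact_uncertaintySet {b : Fin M → ℝ} {U : Fin M → Set ℝ} (hU : ∀ i, IsCompact (U i)) :
    IsCompact (uncertaintySet b U) := by
  have h : uncertaintySet b U =
      WithLp.toLp 2 '' Set.pi Set.univ fun i => (fun u => b i - u) '' U i := by
    ext x
    constructor
    · intro hx
      refine ⟨WithLp.ofLp x, fun i _ => ?_, rfl⟩
      obtain ⟨u, hu, e⟩ := hx i
      exact ⟨u, hu, e.symm⟩
    · rintro ⟨f, hf, rfl⟩ i
      obtain ⟨u, hu, e⟩ := hf i trivial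
      exact ⟨u, hu, e.symm⟩
  rw [h]
  exact (isCompact_univ_pi fun i => (hU i).image (by fun_prop)).image (PiLp.continuous_toLp 2 _)

end Support

/-! ### Gibbs measures, the variational principle, and smoothness of the log-partition function. -/

section Gibbs

variable {K : Set ℝ} {M : ℕ}

theorem continuous_adjointOp (z : EuclideanSpace ℝ (Fin M)) :
    Continuous (adjointOp z : K → ℝ) := by
  unfold adjointOp; fun_prop

theorem adjointOp_add (z w : EuclideanSpace ℝ (Fin M)) (x : K) :
    adjointOp (z + w) x = adjointOp z x + adjointOp w x := by
  simp [adjointOp, add_mul, Finset.sum_add_distrib]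

theorem adjointOp_smul (c : ℝ) (z : EuclideanSpace ℝ (Fin M)) (x : K) :
    adjointOp (c • z) x = c * adjointOp z x := by
  simp [adjointOp, mul_assoc, Finset.mul_sum]

theorem integrable_of_continuous [CompactSpace K] (μ : Measure K) [IsFiniteMeasure μ] {f : K → ℝ}
    (hf : Continuous f) : Integrable f μ :=
  hf.integrable_of_hasCompactSupport (HasCompactSupport.of_compactSpace f)

theorem inner_moments [CompactSpace K] (μ : Measure K) [IsFiniteMeasure μ]
    (z : EuclideanSpace ℝ (Fin M)) : inner ℝ (moments M μ) z = ∫ x, adjointOp z x ∂μ := by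
  unfold adjointOp
  rw [integral_finsetSum _ fun i _ => integrable_of_continuous μ (by fun_prop)]
  simp [moments, PiLp.inner_apply, integral_const_mul]

/-- The exponent of the Gibbs density with respect to the natural base. -/
noncomputable def gibbsExponent (z : EuclideanSpace ℝ (Fin M)) (x : K) : ℝ := -(Real.log 2 * adjointOp z x)

theorem continuous_gibbsExponent (z : EuclideanSpace ℝ (Fin M)) :
    Continuous (gibbsExponent z : K → ℝ) :=
  (continuous_const.mul (continuous_adjointOp z)).neg

theorem integrable_exp_gibbsExponent [CompactSpace K] (μ : Measure K) [IsFiniteMeasure μ]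
    (z : EuclideanSpace ℝ (Fin M)) : Integrable (fun x => Real.exp (gibbsExponent z x)) μ :=
  integrable_of_continuous μ (Real.continuous_exp.comp (continuous_gibbsExponent z))

theorem gibbs_eq_tilted (ν : Measure K) (z : EuclideanSpace ℝ (Fin M)) :
    gibbs ν z = ν.tilted (gibbsExponent z) := by
  have h : ∀ x : K, (2 : ℝ) ^ (-adjointOp z x) = Real.exp (gibbsExponent z x) := fun x => by
    rw [Real.rpow_def_of_pos two_pos, gibbsExponent, mul_neg]
  simp only [gibbs, Measure.tilted, h]

/-- The logarithm to base `2` of the partition function `∫ 2^{-𝒜* z} dν`. -/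
noncomputable def logPartition (ν : Measure K) (z : EuclideanSpace ℝ (Fin M)) : ℝ :=
  Real.log (∫ x, Real.exp (gibbsExponent z x) ∂ν) / Real.log 2

theorem relEntropy_ne_top_iff (ν : Measure K) {μ : Measure K} :
    relEntropy μ ν ≠ ⊤ ↔ μ ≪ ν ∧ Integrable (llr μ ν) μ := by
  rw [← InformationTheory.klDiv_ne_top_iff, relEntropy, ne_eq, ENNReal.div_eq_top]
  have : ENNReal.ofReal (Real.log 2) ≠ 0 := by
    simpa using Real.log_pos one_lt_two
  simp [this]

theorem toReal_relEntropy (ν : Measure K) [IsProbabilityMeasure ν] {μ : Measure K}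
    [IsProbabilityMeasure μ] (h : μ ≪ ν) :
    (relEntropy μ ν).toReal = (∫ x, llr μ ν x ∂μ) / Real.log 2 := by
  rw [relEntropy, ENNReal.toReal_div, ENNReal.toReal_ofReal (Real.log_pos one_lt_two).le,
    InformationTheory.toReal_klDiv_of_measure_eq h (by simp)]

theorem gibbs_absolutelyContinuous (ν : Measure K) (z : EuclideanSpace ℝ (Fin M)) :
    gibbs ν z ≪ ν := by
  rw [gibbs_eq_tilted]; exact tilted_absolutelyContinuous _ _

theorem logPartition_zero (ν : Measure K) [IsProbabilityMeasure ν] :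
    logPartition ν (0 : EuclideanSpace ℝ (Fin M)) = 0 := by
  simp [logPartition, gibbsExponent, adjointOp]

variable [CompactSpace K] (ν : Measure K) [IsProbabilityMeasure ν]

instance isProbabilityMeasure_gibbs (z : EuclideanSpace ℝ (Fin M)) :
    IsProbabilityMeasure (gibbs ν z) := by
  rw [gibbs_eq_tilted]
  exact isProbabilityMeasure_tilted (integrable_exp_gibbsExponent ν z)

theorem integral_gibbsExponent (μ : Measure K) [IsFiniteMeasure μ]
    (z : EuclideanSpace ℝ (Fin M)) :
    ∫ x, gibbsExponent z x ∂μ = -(Real.log 2 * inner ℝ (moments M μ) z) := by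
  rw [inner_moments]
  simp only [gibbsExponent]
  rw [integral_neg, integral_const_mul]

/-- The slack in the variational inequality is exactly the relative entropy, in bits, of `μ` with
respect to the Gibbs measure. -/
theorem integral_llr_gibbs {μ : Measure K} [IsProbabilityMeasure μ] (h : μ ≪ ν)
    (hint : Integrable (llr μ ν) μ) (z : EuclideanSpace ℝ (Fin M)) :
    (∫ x, llr μ (gibbs ν z) x ∂μ) / Real.log 2 =
      (relEntropy μ ν).toReal + inner ℝ (moments M μ) z + logPartition ν z := by
  rw [gibbs_eq_tilted, integral_llr_tilted_right h
    (integrable_of_continuous μ (continuous_gibbsExponent z)) (integrable_exp_gibbsExponent ν z) hint,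
    toReal_relEntropy ν h, integral_gibbsExponent, logPartition]
  have := Real.log_pos one_lt_two
  field_simp
  ring

/-- The Gibbs variational inequality. -/
theorem neg_logPartition_le {μ : Measure K} [IsProbabilityMeasure μ] (h : relEntropy μ ν ≠ ⊤)
    (z : EuclideanSpace ℝ (Fin M)) :
    -logPartition ν z ≤ (relEntropy μ ν).toReal + inner ℝ (moments M μ) z := by
  obtain ⟨hac, hint⟩ := (relEntropy_ne_top_iff ν).1 h
  have h1 := integral_llr_gibbs ν hac hint z
  have hac' : μ ≪ gibbs ν z := by
    rw [gibbs_eq_tilted]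
    exact hac.trans (absolutelyContinuous_tilted (integrable_exp_gibbsExponent ν z))
  have h2 : 0 ≤ ∫ x, llr μ (gibbs ν z) x ∂μ := by
    rw [← InformationTheory.toReal_klDiv_of_measure_eq hac' (by simp)]
    exact ENNReal.toReal_nonneg
  have := div_nonneg h2 (Real.log_pos one_lt_two).le
  linarith

theorem llr_gibbs (z : EuclideanSpace ℝ (Fin M)) :
    llr (gibbs ν z) ν =ᵐ[gibbs ν z]
      fun x => gibbsExponent z x - Real.log (∫ x, Real.exp (gibbsExponent z x) ∂ν) := by
  have := log_rnDeriv_tilted_left_self (integrable_exp_gibbsExponent ν z)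
  have h := (gibbs_absolutelyContinuous ν z).ae_le this
  rw [gibbs_eq_tilted] at h ⊢
  exact h

theorem relEntropy_gibbs_ne_top (z : EuclideanSpace ℝ (Fin M)) :
    relEntropy (gibbs ν z) ν ≠ ⊤ := by
  refine (relEntropy_ne_top_iff ν).2 ⟨gibbs_absolutelyContinuous ν z, ?_⟩
  rw [integrable_congr (llr_gibbs ν z)]
  exact (integrable_of_continuous _ (continuous_gibbsExponent z)).sub (integrable_const _)

theorem toReal_relEntropy_gibbs (z : EuclideanSpace ℝ (Fin M)) :
    (relEntropy (gibbs ν z) ν).toReal =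
      -inner ℝ (moments M (gibbs ν z)) z - logPartition ν z := by
  rw [toReal_relEntropy ν (gibbs_absolutelyContinuous ν z), integral_congr_ae (llr_gibbs ν z),
    integral_sub (integrable_of_continuous _ (continuous_gibbsExponent z)) (integrable_const _),
    integral_gibbsExponent, integral_const, logPartition]
  have := Real.log_pos one_lt_two
  simp
  field_simp

theorem innerMin_eq (z : EuclideanSpace ℝ (Fin M)) : innerMin ν z = -logPartition ν z := by
  refine IsLeast.csInf_eq ⟨⟨⟨gibbs ν z, inferInstance⟩, relEntropy_gibbs_ne_top ν z, ?_⟩, ?_⟩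
  · change _ = (relEntropy (gibbs ν z) ν).toReal + inner ℝ (moments M (gibbs ν z)) z
    rw [toReal_relEntropy_gibbs]; ring
  · rintro r ⟨μ, hμ, rfl⟩
    exact neg_logPartition_le ν hμ z

/-- Tilting twice is tilting by the sum. Increments from any `z` thus become values for the base
measure `gibbs ν z`, and only estimates near the origin are needed. -/
theorem logPartition_sub (z w : EuclideanSpace ℝ (Fin M)) :
    logPartition ν w - logPartition ν z = logPartition (gibbs ν z) (w - z) := by
  have h : ∫ x, Real.exp (gibbsExponent (w - z) x) ∂(gibbs ν z) =
      (∫ x, Real.exp (gibbsExponent w x) ∂ν) / ∫ x, Real.exp (gibbsExponent z x) ∂ν := by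
    rw [gibbs_eq_tilted, integral_exp_tilted]
    congr 3
    ext x
    rw [Pi.add_apply, gibbsExponent, gibbsExponent, gibbsExponent]
    have : adjointOp w x = adjointOp z x + adjointOp (w - z) x := by
      rw [← adjointOp_add, add_sub_cancel]
    rw [this]
    congr 1; ring
  rw [logPartition, logPartition, logPartition, h, Real.log_div
    (integral_exp_pos (integrable_exp_gibbsExponent ν w)).ne'
    (integral_exp_pos (integrable_exp_gibbsExponent ν z)).ne', sub_div]

theorem le_log_integral_exp {f : K → ℝ} (hf : Continuous f) :
    ∫ x, f x ∂ν ≤ Real.log (∫ x, Real.exp (f x) ∂ν) := by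
  have hexp := integrable_of_continuous ν (Real.continuous_exp.comp hf)
  rw [Real.le_log_iff_exp_le (integral_exp_pos hexp)]
  exact convexOn_exp.map_integral_le Real.continuous_exp.continuousOn isClosed_univ
    (ae_of_all _ fun _ => trivial) (integrable_of_continuous ν hf) hexp

/-- Hoeffding's lemma. -/
theorem log_integral_exp_le {f : K → ℝ} (hf : Continuous f) {B : ℝ} (hB : ∀ x, |f x| ≤ B) :
    Real.log (∫ x, Real.exp (f x) ∂ν) ≤ ∫ x, f x ∂ν + B ^ 2 / 2 := by
  have hexp := integrable_of_continuous ν (Real.continuous_exp.comp hf)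
  have h := (ProbabilityTheory.hasSubgaussianMGF_of_mem_Icc (μ := ν) (X := f) (a := -B) (b := B)
    hf.measurable.aemeasurable (ae_of_all _ fun x => abs_le.1 (hB x))).mgf_le 1
  have e1 : ProbabilityTheory.mgf (fun x => f x - ∫ x, f x ∂ν) ν 1 =
      Real.exp (-∫ x, f x ∂ν) * ∫ x, Real.exp (f x) ∂ν := by
    rw [ProbabilityTheory.mgf, ← integral_const_mul]
    congr 1
    ext x
    simp only [one_mul]
    rw [← Real.exp_add]
    congr 1; ring
  have e2 : (((‖B - -B‖₊ / 2) ^ 2 : NNReal) : ℝ) = B ^ 2 := by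
    push_cast
    rw [Real.norm_eq_abs, div_pow, sq_abs]
    ring
  rw [e1, e2] at h
  have h2 := Real.log_le_log
    (mul_pos (Real.exp_pos _) (integral_exp_pos hexp)) h
  rw [Real.log_mul (Real.exp_pos _).ne' (integral_exp_pos hexp).ne', Real.log_exp,
    Real.log_exp] at h2
  simp only [Function.comp_def] at *
  linarith

/-- After rebasing at `gibbs ν z`, Jensen gives the lower bound and Hoeffding the upper one. -/
theorem quadraticBounds_logPartition {a : ℝ}
    (ha : ∀ (z : EuclideanSpace ℝ (Fin M)) (x : K), |adjointOp z x| ≤ a * ‖z‖) :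
    QuadraticBounds (logPartition ν) (fun z => -moments M (gibbs ν z)) 0 (a ^ 2) := by
  intro z w
  have hl := Real.log_pos one_lt_two
  have hl1 : Real.log 2 ≤ 1 := by
    have := Real.log_two_lt_d9; linarith
  rw [logPartition_sub, inner_neg_left, zero_div, zero_mul, sub_neg_eq_add]
  have hc : Continuous (gibbsExponent (w - z) : K → ℝ) := continuous_gibbsExponent _
  have h1 := le_log_integral_exp (gibbs ν z) hc
  have h2 := log_integral_exp_le (gibbs ν z) hc (B := Real.log 2 * (a * ‖w - z‖)) fun x => by
    rw [gibbsExponent, abs_neg, abs_mul, abs_of_pos hl]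
    exact mul_le_mul_of_nonneg_left (ha _ _) hl.le
  rw [integral_gibbsExponent] at h1 h2
  set X := Real.log (∫ x, Real.exp (gibbsExponent (w - z) x) ∂(gibbs ν z)) with hX
  have hlp : logPartition (gibbs ν z) (w - z) = X / Real.log 2 := rfl
  rw [hlp]
  set I := inner ℝ (moments M (gibbs ν z)) (w - z)
  constructor
  · have : 0 ≤ (X + Real.log 2 * I) / Real.log 2 := div_nonneg (by linarith) hl.le
    rw [add_div, mul_div_cancel_left₀ _ hl.ne'] at this
    exact this
  · have : (X + Real.log 2 * I) / Real.log 2 ≤ (Real.log 2 * (a * ‖w - z‖)) ^ 2 / 2 / Real.log 2 :=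
      div_le_div_of_nonneg_right (by linarith) hl.le
    rw [add_div, mul_div_cancel_left₀ _ hl.ne'] at this
    refine this.trans ?_
    -- Base 2 leaves one factor `log 2 ≤ 1`, which is discarded; the curvature `a²` is not sharp.
    have e : (Real.log 2 * (a * ‖w - z‖)) ^ 2 / 2 / Real.log 2 =
        Real.log 2 * (a ^ 2 / 2 * ‖w - z‖ ^ 2) := by field_simp
    rw [e]
    exact mul_le_of_le_one_left (by positivity) hl1

end Gibbs

/-! ### The norm of the moment operator bounds the adjoint pointwise. -/

section OpNorm

variable {K : Set ℝ} {M : ℕ} [CompactSpace K]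

/-- Boundedness is needed for the real supremum in `opNorm` to be an upper bound for its set. -/
theorem norm_momentOp_le : ∃ R : ℝ, ∀ μ : SignedMeasure K, μ.totalVariation Set.univ = 1 →
    ‖momentOp M μ‖ ≤ R := by
  obtain ⟨R, hR⟩ : ∃ R : ℝ, ∀ (i : Fin M) (x : K), ‖(x : ℝ) ^ ((i : ℕ) + 1)‖ ≤ R := by
    have : ∀ i : Fin M, ∃ R : ℝ, ∀ x : K, ‖(x : ℝ) ^ ((i : ℕ) + 1)‖ ≤ R := fun i => by
      obtain ⟨R, hR⟩ := isCompact_univ.exists_bound_of_continuousOn (s := (Set.univ : Set K))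
        (f := fun x : K => (x : ℝ) ^ ((i : ℕ) + 1)) (by fun_prop)
      exact ⟨R, fun x => hR x trivial⟩
    choose R hR using this
    exact ⟨∑ i, |R i|, fun i x => (hR i x).trans ((le_abs_self _).trans
      (Finset.single_le_sum (f := fun i => |R i|) (fun _ _ => abs_nonneg _) (Finset.mem_univ i)))⟩
  refine ⟨√(∑ _i : Fin M, (R * ‖(ContinuousLinearMap.lsmul ℝ ℝ : ℝ →L[ℝ] ℝ →L[ℝ] ℝ).flip‖) ^ 2),
    fun μ hμ => ?_⟩
  rw [EuclideanSpace.norm_eq]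
  refine Real.sqrt_le_sqrt (Finset.sum_le_sum fun i _ => ?_)
  rw [SignedMeasure.totalVariation_eq_variation] at hμ
  have : IsFiniteMeasure μ.variation := ⟨by rw [hμ]; exact ENNReal.one_lt_top⟩
  have h := VectorMeasure.norm_integral_le_of_norm_le_const (μ := μ)
    (B := (ContinuousLinearMap.lsmul ℝ ℝ : ℝ →L[ℝ] ℝ →L[ℝ] ℝ).flip)
    (ae_of_all _ fun x : K => hR i x)
  rw [Measure.real, hμ, ENNReal.toReal_one, mul_one] at h
  exact pow_le_pow_left₀ (norm_nonneg _) h 2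

theorem abs_adjointOp_le (z : EuclideanSpace ℝ (Fin M)) (x : K) :
    |adjointOp z x| ≤ opNorm K M * ‖z‖ := by
  obtain ⟨R, hR⟩ := norm_momentOp_le (K := K) (M := M)
  have hbdd : BddAbove {r : ℝ | ∃ (μ : SignedMeasure K) (y : EuclideanSpace ℝ (Fin M)),
      μ.totalVariation Set.univ = 1 ∧ ‖y‖ = 1 ∧ r = inner ℝ (momentOp M μ) y} := by
    refine ⟨R, ?_⟩
    rintro r ⟨μ, y, hμ, hy, rfl⟩
    have := real_inner_le_norm (momentOp M μ) y
    rw [hy, mul_one] at this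
    exact this.trans (hR μ hμ)
  have hunit : ∀ y : EuclideanSpace ℝ (Fin M), ‖y‖ = 1 → adjointOp y x ≤ opNorm K M := by
    intro y hy
    -- The Dirac mass at `x` has total variation one and pairs with `y` to `adjointOp y x`.
    refine le_csSup hbdd ⟨(Measure.dirac x).toSignedMeasure, y, ?_, hy, ?_⟩
    · rw [SignedMeasure.totalVariation_eq_variation, Measure.variation_toSignedMeasure]
      simp
    · rw [momentOp_toSignedMeasure, inner_moments, integral_dirac]
  have hle : ∀ y : EuclideanSpace ℝ (Fin M), adjointOp y x ≤ opNorm K M * ‖y‖ := by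
    intro y
    rcases eq_or_ne y 0 with rfl | hy
    · simp [adjointOp]
    · have hn := norm_pos_iff.2 hy
      have h := hunit (‖y‖⁻¹ • y) (by rw [norm_smul, norm_inv, norm_norm, inv_mul_cancel₀ hn.ne'])
      rw [adjointOp_smul, inv_mul_le_iff₀ hn] at h
      linarith
  refine abs_le.2 ⟨?_, hle z⟩
  have := hle (-z)
  rw [norm_neg, ← neg_one_smul ℝ z, adjointOp_smul] at this
  linarith

end OpNorm

/-! ### Weak and strong duality, and the smoothed dual function. -/

section Duality

variable {K : Set ℝ} {M : ℕ}

theorem exists_forall_le_of_norm_gt {f : EuclideanSpace ℝ (Fin M) → ℝ} (hf : Continuous f) {R : ℝ}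
    (h : ∀ y, R < ‖y‖ → f 0 ≤ f y) : ∃ x, ∀ y, f x ≤ f y := by
  obtain ⟨x, -, hx⟩ := (isCompact_closedBall (0 : EuclideanSpace ℝ (Fin M)) |R|).exists_isMinOn
    ⟨0, by simp⟩ hf.continuousOn
  refine ⟨x, fun y => ?_⟩
  rcases le_or_gt ‖y‖ |R| with hy | hy
  · exact hx (mem_closedBall_zero_iff.2 hy)
  · exact (hx (by simp)).trans (h y ((le_abs_self R).trans_lt hy))

/-- Relative entropy vanishes only at equality, so `μ₀ ≠ ν` provides `C > 0`. -/
theorem relEntropy_toReal_pos {μ₀ ν : ProbabilityMeasure K}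
    (hfin : relEntropy (μ₀ : Measure K) (ν : Measure K) ≠ ⊤) (hne : μ₀ ≠ ν) :
    0 < (relEntropy (μ₀ : Measure K) (ν : Measure K)).toReal := by
  refine ENNReal.toReal_pos (fun h => hne ?_) hfin
  rw [relEntropy, ENNReal.div_eq_zero_iff] at h
  have h0 := h.resolve_right ENNReal.ofReal_ne_top
  have h1 : (μ₀ : Measure K) = ν := InformationTheory.klDiv_eq_zero_iff.1 h0
  exact Subtype.ext h1

variable {T : Set (EuclideanSpace ℝ (Fin M))} [CompactSpace K] {ν : Measure K}
  [IsProbabilityMeasure ν]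

theorem dualFun_eq (z : EuclideanSpace ℝ (Fin M)) :
    dualFun ν T z = -supportFun T z - logPartition ν z := by
  rw [dualFun, innerMin_eq, sub_eq_add_neg]

/-- Weak duality. -/
theorem dualFun_le_relEntropy (hT : IsCompact T) {μ : Measure K} [IsProbabilityMeasure μ]
    (hμ : relEntropy μ ν ≠ ⊤) (hmem : moments M μ ∈ T) (z : EuclideanSpace ℝ (Fin M)) :
    dualFun ν T z ≤ (relEntropy μ ν).toReal := by
  have h1 := neg_logPartition_le ν hμ z
  have h2 := inner_le_supportFun hT hmem z
  rw [dualFun_eq]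
  linarith

/-- The variational inequality is tested with the Slater measure, and the ball around its moments
pays `δ‖z‖`. Existence and norm bounds of the dual maximizers rest on this. -/
theorem dualFun_le_sub_norm (hT : IsCompact T) {μ₀ : Measure K} [IsProbabilityMeasure μ₀]
    (hμ : relEntropy μ₀ ν ≠ ⊤) {δ : ℝ} (hδ : 0 ≤ δ)
    (hball : Metric.closedBall (moments M μ₀) δ ⊆ T) (z : EuclideanSpace ℝ (Fin M)) :
    dualFun ν T z ≤ (relEntropy μ₀ ν).toReal - δ * ‖z‖ := by
  have h1 := neg_logPartition_le ν hμ z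
  have h2 := le_supportFun_of_closedBall_subset hT hδ hball z
  rw [dualFun_eq]
  linarith

/-- Strong duality under a Slater condition: the primal problem is solved by a Gibbs measure. -/
theorem exists_dual_optimal (hT : IsCompact T) (hc : Convex ℝ T) {μ₀ : Measure K}
    [IsProbabilityMeasure μ₀] (hμ : relEntropy μ₀ ν ≠ ⊤) {δ : ℝ} (hδ : 0 < δ)
    (hball : Metric.closedBall (moments M μ₀) δ ⊆ T) :
    ∃ z : EuclideanSpace ℝ (Fin M), moments M (gibbs ν z) ∈ T ∧
      (relEntropy (gibbs ν z) ν).toReal = dualFun ν T z ∧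
      δ * ‖z‖ ≤ (relEntropy μ₀ ν).toReal := by
  have hne : T.Nonempty := ⟨_, hball (Metric.mem_closedBall_self hδ.le)⟩
  have hΛ := quadraticBounds_logPartition ν (abs_adjointOp_le (K := K) (M := M))
  have hcont : Continuous (logPartition ν : EuclideanSpace ℝ (Fin M) → ℝ) :=
    continuous_iff_continuousAt.2 fun z => (hΛ.hasGradientAt z).differentiableAt.continuousAt
  have hbound := dualFun_le_sub_norm hT hμ hδ.le hball
  simp only [dualFun_eq] at hbound
  have hzero : supportFun T 0 + logPartition ν (0 : EuclideanSpace ℝ (Fin M)) = 0 := by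
    rw [supportFun_zero hne, logPartition_zero, add_zero]
  obtain ⟨z, hz⟩ := exists_forall_le_of_norm_gt (f := fun z => supportFun T z + logPartition ν z)
    ((continuous_supportFun hT).add hcont) (R := (relEntropy μ₀ ν).toReal / δ) fun w hw => by
      rw [div_lt_iff₀' hδ] at hw
      rw [hzero]
      linarith [hbound w]
  -- The gradient of `logPartition` is minus the Gibbs moments, so optimality is primal feasibility
  -- together with complementary slackness.
  obtain ⟨hmem, hσ⟩ := optimality_of_isMin hT hc hne hΛ hz
  rw [neg_neg] at hmem hσ
  refine ⟨z, hmem, ?_, ?_⟩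
  · rw [dualFun_eq, toReal_relEntropy_gibbs, hσ]
  · have h0 := hz 0
    rw [hzero] at h0
    linarith [hbound z]

theorem smoothedDualFun_eq (η₁ η₂ : ℝ) (z : EuclideanSpace ℝ (Fin M)) :
    -smoothedDualFun ν T η₁ η₂ z =
      smoothedSupportFun T η₁ z + logPartition ν z + η₂ / 2 * ‖z‖ ^ 2 := by
  rw [smoothedDualFun, innerMin_eq]
  ring

/-- Curvatures add, and only the quadratic term contributes to the lower one. The gradient is kept
explicit because it compares `p z` with the Gibbs moments. -/
theorem exists_smoothedDualFun_bounds (hT : IsCompact T) (hc : Convex ℝ T) (hne : T.Nonempty)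
    {η₁ : ℝ} (hη₁ : 0 < η₁) (η₂ : ℝ) :
    ∃ p : EuclideanSpace ℝ (Fin M) → EuclideanSpace ℝ (Fin M), (∀ z, p z ∈ T) ∧
      (∀ z, smoothedSupportFun T η₁ z = inner ℝ (p z) z - η₁ / 2 * ‖p z‖ ^ 2) ∧
      QuadraticBounds (fun z => -smoothedDualFun ν T η₁ η₂ z)
        (fun z => p z + -moments M (gibbs ν z) + η₂ • z) η₂ (lipConst K M η₁ η₂) := by
  obtain ⟨p, hp, hval, hb⟩ := exists_smoothedSupportFun_bounds hT hc hne hη₁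
  refine ⟨p, hp, hval, ?_⟩
  have h := (hb.add (quadraticBounds_logPartition ν (abs_adjointOp_le (K := K) (M := M)))).add
    (quadraticBounds_norm_sq η₂)
  simp only [zero_add] at h
  simp only [smoothedDualFun_eq]
  exact h

theorem differentiable_smoothedDualFun (hT : IsCompact T) (hc : Convex ℝ T) (hne : T.Nonempty)
    {η₁ : ℝ} (hη₁ : 0 < η₁) (η₂ : ℝ) : Differentiable ℝ (smoothedDualFun ν T η₁ η₂) := by
  obtain ⟨p, -, -, hb⟩ := exists_smoothedDualFun_bounds (ν := ν) hT hc hne hη₁ η₂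
  intro z
  have := (hb.hasGradientAt z).differentiableAt.neg
  simpa [Pi.neg_def] using this

theorem dualFun_sub_le_smoothedDualFun (hT : IsCompact T) (hne : T.Nonempty) {η₁ : ℝ}
    (hη₁ : 0 ≤ η₁) (η₂ : ℝ) (z : EuclideanSpace ℝ (Fin M)) :
    dualFun ν T z - η₂ / 2 * ‖z‖ ^ 2 ≤ smoothedDualFun ν T η₁ η₂ z := by
  have h := smoothedSupportFun_le_supportFun hT hne hη₁ z
  have h2 := smoothedDualFun_eq (ν := ν) (T := T) η₁ η₂ z
  rw [dualFun_eq]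
  linarith

theorem smoothedDualFun_le_dualFun (hT : IsCompact T) (hne : T.Nonempty) {η₁ : ℝ}
    (hη₁ : 0 ≤ η₁) (η₂ : ℝ) (z : EuclideanSpace ℝ (Fin M)) :
    smoothedDualFun ν T η₁ η₂ z ≤ dualFun ν T z + η₁ * proxBound T - η₂ / 2 * ‖z‖ ^ 2 := by
  have h := supportFun_le_smoothedSupportFun hT hne hη₁
    (fun x hx => norm_sq_le_proxBound hT hx) z
  have h2 := smoothedDualFun_eq (ν := ν) (T := T) η₁ η₂ z
  rw [dualFun_eq]
  linarith

theorem exists_smoothedDual_optimal (hT : IsCompact T) (hc : Convex ℝ T) {μ₀ : Measure K}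
    [IsProbabilityMeasure μ₀] (hμ : relEntropy μ₀ ν ≠ ⊤) {δ : ℝ} (hδ : 0 < δ)
    (hball : Metric.closedBall (moments M μ₀) δ ⊆ T) {η₁ η₂ : ℝ} (hη₁ : 0 < η₁) (hη₂ : 0 ≤ η₂) :
    ∃ z, (∀ w, smoothedDualFun ν T η₁ η₂ w ≤ smoothedDualFun ν T η₁ η₂ z) ∧
      δ * ‖z‖ + η₂ / 2 * ‖z‖ ^ 2 ≤ (relEntropy μ₀ ν).toReal + η₁ * proxBound T := by
  have hne : T.Nonempty := ⟨_, hball (Metric.mem_closedBall_self hδ.le)⟩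
  have hle : ∀ w, smoothedDualFun ν T η₁ η₂ w ≤ (relEntropy μ₀ ν).toReal - δ * ‖w‖ +
      η₁ * proxBound T - η₂ / 2 * ‖w‖ ^ 2 := fun w => by
    have := smoothedDualFun_le_dualFun (ν := ν) hT hne hη₁.le η₂ w
    linarith [dualFun_le_sub_norm hT hμ hδ.le hball w]
  have hzero : 0 ≤ smoothedDualFun ν T η₁ η₂ 0 := by
    have := dualFun_sub_le_smoothedDualFun (ν := ν) hT hne hη₁.le η₂ 0
    rw [dualFun_eq, supportFun_zero hne, logPartition_zero] at this
    simpa using this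
  obtain ⟨z, hz⟩ := exists_forall_le_of_norm_gt (f := fun z => -smoothedDualFun ν T η₁ η₂ z)
    (differentiable_smoothedDualFun hT hc hne hη₁ η₂).continuous.neg
    (R := ((relEntropy μ₀ ν).toReal + η₁ * proxBound T) / δ) fun w hw => by
      rw [div_lt_iff₀' hδ] at hw
      have : 0 ≤ η₂ / 2 * ‖w‖ ^ 2 := by positivity
      linarith [hle w]
  refine ⟨z, fun w => neg_le_neg_iff.1 (hz w), ?_⟩
  have := hz 0
  linarith [hle z]

/-- The residual between the moments of the Gibbs measure and the maximizer of the smoothed support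
function controls both feasibility and the duality gap. -/
theorem gibbs_estimates (hT : IsCompact T) (hne : T.Nonempty) {η₁ : ℝ} (hη₁ : 0 ≤ η₁)
    {z p : EuclideanSpace ℝ (Fin M)} (hp : p ∈ T)
    (hval : smoothedSupportFun T η₁ z = inner ℝ p z - η₁ / 2 * ‖p‖ ^ 2) :
    Metric.infDist (moments M (gibbs ν z)) T ≤ ‖p - moments M (gibbs ν z)‖ ∧
    |(relEntropy (gibbs ν z) ν).toReal - dualFun ν T z| ≤
      η₁ * proxBound T + ‖p - moments M (gibbs ν z)‖ * ‖z‖ := by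
  constructor
  · have := Metric.infDist_le_dist_of_mem (x := moments M (gibbs ν z)) hp
    rwa [dist_eq_norm, norm_sub_rev] at this
  -- The partition functions cancel, leaving `σ_T(z) - ⟨𝒜μ̂, z⟩`, which is split at `⟨p, z⟩`:
  -- smoothing error plus residual.
  · have h1 := inner_le_supportFun hT hp z
    have h2 := supportFun_le_smoothedSupportFun hT hne hη₁
      (fun x hx => norm_sq_le_proxBound hT hx) z
    have h3 : 0 ≤ η₁ / 2 * ‖p‖ ^ 2 := by positivity
    have h4 := abs_le.1 (abs_real_inner_le_norm (p - moments M (gibbs ν z)) z)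
    rw [inner_sub_left] at h4
    have h5 : 0 ≤ η₁ * proxBound T := mul_nonneg hη₁ (by
      have := norm_sq_le_proxBound hT hp
      have := sq_nonneg ‖p‖
      linarith)
    rw [toReal_relEntropy_gibbs, dualFun_eq, abs_le]
    constructor <;> linarith [h4.1, h4.2]

end Duality

/-! ### What the two iteration bounds buy. -/

section Constants

variable {C D δ a ε : ℝ}

theorem pow_one_sub_le {S X : ℝ} (hS : 1 ≤ S) (hX : 0 < X) {k : ℕ} (hk : 2 * S * Real.log X ≤ k) :
    (1 - 1 / S) ^ k ≤ 1 / X ^ 2 := by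
  have hS0 : 0 < S := one_pos.trans_le hS
  have h0 : 0 ≤ 1 - 1 / S := by
    rw [sub_nonneg, div_le_one hS0]; exact hS
  have h1 : 1 - 1 / S ≤ Real.exp (-(1 / S)) := by
    have := Real.add_one_le_exp (-(1 / S)); linarith
  calc (1 - 1 / S) ^ k ≤ Real.exp (-(1 / S)) ^ k := pow_le_pow_left₀ h0 h1 k
    _ = Real.exp (-(k / S)) := by rw [← Real.exp_nat_mul]; congr 1; ring
    _ ≤ Real.exp (-(2 * Real.log X)) := by
      rw [Real.exp_le_exp, neg_le_neg_iff, le_div_iff₀ hS0]; linarith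
    _ = 1 / X ^ 2 := by
      rw [Real.exp_neg, one_div, ← Real.exp_log (pow_pos hX 2), Real.log_pow]; norm_num

/-- The factor `S(ε)` in the iteration counts is `√(L/η₂)`, so the contraction factor is `1 - 1/S`.
-/
theorem sqrt_condition_number (hC : 0 < C) (hD : 0 < D) (hδ : 0 < δ) (hε : 0 < ε) :
    √(eta₂ C δ ε / (1 / eta₁ D ε + a ^ 2 + eta₂ C δ ε)) =
      1 / √(8 * D * C ^ 2 / (ε ^ 2 * δ ^ 2) + 2 * a ^ 2 * C ^ 2 / (ε * δ ^ 2) + 1) := by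
  have h : eta₂ C δ ε / (1 / eta₁ D ε + a ^ 2 + eta₂ C δ ε) =
      (8 * D * C ^ 2 / (ε ^ 2 * δ ^ 2) + 2 * a ^ 2 * C ^ 2 / (ε * δ ^ 2) + 1)⁻¹ := by
    unfold eta₁ eta₂
    rw [← one_div, div_eq_div_iff (by positivity) (by positivity)]
    field_simp
    ring
  rw [h, Real.sqrt_inv, one_div]

theorem one_le_sqrt_condition (hD : 0 < D) (hε : 0 < ε) :
    1 ≤ √(8 * D * C ^ 2 / (ε ^ 2 * δ ^ 2) + 2 * a ^ 2 * C ^ 2 / (ε * δ ^ 2) + 1) := by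
  rw [Real.one_le_sqrt]
  have : 0 ≤ 8 * D * C ^ 2 / (ε ^ 2 * δ ^ 2) + 2 * a ^ 2 * C ^ 2 / (ε * δ ^ 2) := by positivity
  linarith

theorem contraction_le_of_N₁ (hC : 0 < C) (hD : 0 < D) (hε : 0 < ε) {k : ℕ}
    (hk : N₁ C D δ a ε ≤ k) :
    (1 - 1 / √(8 * D * C ^ 2 / (ε ^ 2 * δ ^ 2) + 2 * a ^ 2 * C ^ 2 / (ε * δ ^ 2) + 1)) ^ k *
      (C + ε / 2) ≤ ε ^ 2 / (200 * (ε + 2 * C)) := by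
  have h := pow_one_sub_le (one_le_sqrt_condition hD hε)
    (by positivity : 0 < 10 * (ε + 2 * C) / ε) hk
  refine (mul_le_mul_of_nonneg_right h (by positivity)).trans_eq ?_
  field_simp
  ring

theorem contraction_le_of_N₂ (hC : 0 < C) (hD : 0 < D) (hδ : 0 < δ) (hε : 0 < ε) {k : ℕ}
    (hk : N₂ C D δ a ε ≤ k) :
    (1 - 1 / √(8 * D * C ^ 2 / (ε ^ 2 * δ ^ 2) + 2 * a ^ 2 * C ^ 2 / (ε * δ ^ 2) + 1)) ^ k *
      (C + ε / 2) ≤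
        (ε * δ / (5 * C)) ^ 2 / (2 * (1 / eta₁ D ε + a ^ 2 + eta₂ C δ ε)) := by
  have h3 : √3 ^ 2 = 3 := Real.sq_sqrt (by norm_num)
  have h3a : 1.73 < √3 := Real.lt_sqrt_of_sq_lt (by norm_num)
  have h3b : √3 < 2 := by rw [Real.sqrt_lt' two_pos]; norm_num
  have e1 : 1 / eta₁ D ε = 4 * D / ε := by unfold eta₁; field_simp
  have e2 : eta₂ C δ ε = ε * δ ^ 2 / (2 * C ^ 2) := rfl
  rw [e1, e2]
  set L := 4 * D / ε + a ^ 2 + ε * δ ^ 2 / (2 * C ^ 2) with hL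
  have hLpos : 0 < L := by positivity
  have hs : 0 < 2 - √3 := by linarith
  have hX : 0 < C / (ε * δ * (2 - √3)) * √(4 * L * (C + ε / 2)) :=
    mul_pos (by positivity) (Real.sqrt_pos.2 (by positivity))
  have h := pow_one_sub_le (one_le_sqrt_condition hD hε) hX hk
  refine (mul_le_mul_of_nonneg_right h (by positivity)).trans ?_
  rw [mul_pow, Real.sq_sqrt (by positivity)]
  have e3 : 1 / ((C / (ε * δ * (2 - √3))) ^ 2 * (4 * L * (C + ε / 2))) * (C + ε / 2) =
      (2 - √3) ^ 2 * ((ε * δ / C) ^ 2 / (4 * L)) := by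
    field_simp
  have e4 : (ε * δ / (5 * C)) ^ 2 / (2 * L) = 2 / 25 * ((ε * δ / C) ^ 2 / (4 * L)) := by
    field_simp; norm_num
  rw [e3, e4]
  -- What remains is `(2 - √3)² ≤ 2/25`, where `2/25` comes from the target `1/5` for the gradient.
  gcongr
  nlinarith

end Constants

/-! ### From the smoothed gap to an approximate primal-dual pair. -/

section Convergence

variable {K : Set ℝ} {M : ℕ} {T : Set (EuclideanSpace ℝ (Fin M))} [CompactSpace K] {ν : Measure K}
  [IsProbabilityMeasure ν]

/-- A dual point whose smoothed optimality gap is small yields an approximate primal-dual pair. -/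
theorem approximate_solution (hT : IsCompact T) (hc : Convex ℝ T) {μ₀ : Measure K}
    [IsProbabilityMeasure μ₀] (hμ : relEntropy μ₀ ν ≠ ⊤) {δ C D ε : ℝ} (hδ : 0 < δ)
    (hball : Metric.closedBall (moments M μ₀) δ ⊆ T)
    (hC : C = (relEntropy μ₀ ν).toReal) (hCpos : 0 < C) (hD : D = proxBound T) (hDpos : 0 < D)
    (hε : 0 < ε) {z₀ : EuclideanSpace ℝ (Fin M)} (hz₀ : δ * ‖z₀‖ ≤ C)
    {k : ℕ} (hk : iterations C D δ (opNorm K M) ε = k) {z : EuclideanSpace ℝ (Fin M)}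
    (hz : z = (fastGradient (smoothedDualFun ν T (eta₁ D ε) (eta₂ C δ ε))
      (lipConst K M (eta₁ D ε) (eta₂ C δ ε)) (eta₂ C δ ε) k).1)
    (hmem : moments M (gibbs ν z₀) ∈ T)
    (hopt : (relEntropy (gibbs ν z₀) ν).toReal = dualFun ν T z₀) :
    dualFun ν T z₀ - dualFun ν T z ≤ ε ∧
    |(relEntropy (gibbs ν z) ν).toReal - dualFun ν T z₀| ≤ 2 * (1 + 2 * √3) * ε ∧
    Metric.infDist (moments M (gibbs ν z)) T ≤ 2 * ε * δ / C := by
  have hne : T.Nonempty := ⟨_, hball (Metric.mem_closedBall_self hδ.le)⟩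
  have hη₁ : 0 < eta₁ D ε := by unfold eta₁; positivity
  have hη₂ : 0 < eta₂ C δ ε := by unfold eta₂; positivity
  have hη₁D : eta₁ D ε * proxBound T = ε / 4 := by rw [← hD]; unfold eta₁; field_simp
  set η₁ := eta₁ D ε with hη₁def
  set η₂ := eta₂ C δ ε with hη₂def
  set G := smoothedDualFun ν T η₁ η₂ with hG
  set L := lipConst K M η₁ η₂ with hL
  set a := opNorm K M with ha
  have hLη : η₂ ≤ L := by
    have : 0 ≤ 1 / η₁ + a ^ 2 := by positivity
    rw [hL, lipConst]; linarith
  have hLpos : 0 < L := hη₂.trans_le hLη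
  obtain ⟨p, hp, hval, hb⟩ := exists_smoothedDualFun_bounds (ν := ν) hT hc hne hη₁ η₂
  obtain ⟨x, hx, hxn⟩ := exists_smoothedDual_optimal hT hc hμ hδ hball hη₁ hη₂.le
  have hxmin : ∀ y, -G x ≤ -G y := fun y => neg_le_neg (hx y)
  rw [← hC, hη₁D] at hxn
  -- the smoothed maximizer has norm at most `C / δ`
  have hη₂sq : ∀ t : ℝ, η₂ / 2 * t ^ 2 = ε / 4 * (δ * t / C) ^ 2 := fun t => by
    rw [hη₂def, eta₂]; field_simp; ring
  have hnorm : ∀ w : EuclideanSpace ℝ (Fin M), δ * ‖w‖ ≤ C → η₂ / 2 * ‖w‖ ^ 2 ≤ ε / 4 := by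
    intro w hw
    rw [hη₂sq]
    have h1 : δ * ‖w‖ / C ≤ 1 := (div_le_one hCpos).2 hw
    have h2 : (δ * ‖w‖ / C) ^ 2 ≤ 1 := pow_le_one₀ (by positivity) h1
    exact mul_le_of_le_one_right (by positivity) h2
  -- The choice of `η₂` makes the penalty equal `ε/4` at norm `C/δ`, so a larger norm would push the
  -- left side of `hxn` above `C + ε/4`.
  have hxC : δ * ‖x‖ ≤ C := by
    by_contra hcon
    rw [not_le] at hcon
    rw [hη₂sq] at hxn
    have h1 : 1 < δ * ‖x‖ / C := (one_lt_div hCpos).2 hcon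
    have h2 : 1 ≤ (δ * ‖x‖ / C) ^ 2 := one_le_pow₀ h1.le
    have h3 := mul_le_mul_of_nonneg_left h2 (by positivity : 0 ≤ ε / 4)
    linarith
  -- the smoothed optimality gap
  have hJC : dualFun ν T x ≤ C := by
    have := dualFun_le_sub_norm hT hμ hδ.le hball x
    have : 0 ≤ δ * ‖x‖ := by positivity
    linarith
  have hG0 : 0 ≤ G 0 := by
    have := dualFun_sub_le_smoothedDualFun (ν := ν) hT hne hη₁.le η₂ 0
    rw [dualFun_eq, supportFun_zero hne, logPartition_zero] at this
    simpa using this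
  have hGx : G x ≤ C + ε / 4 - η₂ / 2 * ‖x‖ ^ 2 := by
    have := smoothedDualFun_le_dualFun (ν := ν) hT hne hη₁.le η₂ x
    rw [hη₁D] at this
    linarith
  -- The penalty cancels against the one in `hGx`. Even `C + ε/4` holds; `C + ε/2` is the quantity
  -- built into `N₁` and `N₂`.
  have hinit : G x - G 0 + η₂ / 2 * ‖x‖ ^ 2 ≤ C + ε / 2 := by linarith
  have hrate := fastGradient_gap_le hb hη₂ hLη x k
  rw [← hz] at hrate
  have hS : √(η₂ / L) = _ := sqrt_condition_number (a := a) hCpos hDpos hδ hε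
  rw [hS] at hrate
  have hpow : 0 ≤ (1 - 1 / √(8 * D * C ^ 2 / (ε ^ 2 * δ ^ 2) +
      2 * a ^ 2 * C ^ 2 / (ε * δ ^ 2) + 1)) ^ k := by
    refine pow_nonneg ?_ k
    have := one_le_sqrt_condition (C := C) (δ := δ) (a := a) hDpos hε
    rw [sub_nonneg, div_le_one (by positivity)]
    exact this
  have hgap := hrate.trans (mul_le_mul_of_nonneg_left hinit hpow)
  have hkmax : max (N₁ C D δ a ε) (N₂ C D δ a ε) ≤ k := by
    rw [← hk]; exact Nat.le_ceil _
  have hgap₁ := hgap.trans (contraction_le_of_N₁ hCpos hDpos hε ((le_max_left _ _).trans hkmax))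
  have hgap₂ : G x - G z ≤ (ε * δ / (5 * C)) ^ 2 / (2 * L) :=
    hgap.trans (contraction_le_of_N₂ hCpos hDpos hδ hε ((le_max_right _ _).trans hkmax))
  -- the gradient at the iterate and the distance to the smoothed maximizer
  have hgrad : ‖p z + -moments M (gibbs ν z) + η₂ • z‖ ≤ ε * δ / (5 * C) := by
    refine le_of_sq_le_sq ?_ (by positivity)
    refine (hb.norm_sq_le hLpos hxmin z).trans ?_
    rw [le_div_iff₀ (by positivity)] at hgap₂
    linarith
  have hdist := hb.dist_sq_le hLpos hxmin z
  have hdistη : η₂ * ‖z - x‖ ≤ ε * δ / (5 * C) := by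
    refine le_of_sq_le_sq ?_ (by positivity)
    have h1 : (η₂ * ‖z - x‖) ^ 2 = 2 * η₂ * (η₂ / 2 * ‖z - x‖ ^ 2) := by ring
    rw [h1]
    have h2 : 2 * η₂ * (η₂ / 2 * ‖z - x‖ ^ 2) ≤ 2 * L * (η₂ / 2 * ‖z - x‖ ^ 2) := by gcongr
    rw [le_div_iff₀ (by positivity)] at hgap₂
    have h3 := mul_le_mul_of_nonneg_left hdist (by positivity : 0 ≤ 2 * L)
    linarith
  have hgap₁' : ε ^ 2 / (200 * (ε + 2 * C)) ≤ ε / 200 := by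
    rw [div_le_div_iff₀ (by positivity) (by positivity)]
    have : 0 ≤ ε * C := by positivity
    nlinarith
  -- Strong convexity and the gap `ε/200 ≤ (ε/4)(1/5)²` give the factor `1/5`, hence `6/5` for the
  -- iterate.
  have hdistx : δ * ‖z - x‖ ≤ C / 5 := by
    refine le_of_sq_le_sq ?_ (by positivity)
    rw [hη₂sq] at hdist
    have h1 : ε / 4 * (δ * ‖z - x‖ / C) ^ 2 ≤ ε / 4 * (1 / 25) := by linarith
    have h2 := le_of_mul_le_mul_left h1 (by positivity)
    rw [div_pow, div_le_iff₀ (by positivity)] at h2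
    linarith
  have hznorm : δ * ‖z‖ ≤ 6 / 5 * C := by
    have : ‖z‖ ≤ ‖z - x‖ + ‖x‖ := norm_le_norm_sub_add z x
    have := mul_le_mul_of_nonneg_left this hδ.le
    linarith
  have hηx : η₂ * ‖x‖ ≤ ε * δ / (2 * C) := by
    have h1 : η₂ * ‖x‖ = ε * δ / (2 * C ^ 2) * (δ * ‖x‖) := by rw [hη₂def, eta₂]; ring
    have h2 : ε * δ / (2 * C) = ε * δ / (2 * C ^ 2) * C := by field_simp
    rw [h1, h2]
    gcongr
  -- Splitting `η₂ z` at the smoothed maximizer `x` gives `9/10 = 1/5 + 1/5 + 1/2`: gradient,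
  -- distance to `x`, and size of `x`.
  have hres : ‖p z - moments M (gibbs ν z)‖ ≤ 9 / 10 * (ε * δ / C) := by
    have e : p z - moments M (gibbs ν z) =
        (p z + -moments M (gibbs ν z) + η₂ • z) - η₂ • (z - x) - η₂ • x := by module
    have h1 := norm_sub_le ((p z + -moments M (gibbs ν z) + η₂ • z) - η₂ • (z - x)) (η₂ • x)
    have h2 := norm_sub_le (p z + -moments M (gibbs ν z) + η₂ • z) (η₂ • (z - x))
    rw [← e] at h1
    rw [norm_smul, Real.norm_of_nonneg hη₂.le] at h1 h2
    have e5 : ε * δ / (5 * C) = 1 / 5 * (ε * δ / C) := by field_simp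
    have e2 : ε * δ / (2 * C) = 1 / 2 * (ε * δ / C) := by field_simp
    rw [e5] at hgrad hdistη
    rw [e2] at hηx
    linarith
  obtain ⟨hfeas, hprimal⟩ := gibbs_estimates (ν := ν) hT hne hη₁.le (hp z) (hval z)
  -- The error is `ε/4` for each smoothing plus the gap `ε/200`.
  have hdual : dualFun ν T z₀ - dualFun ν T z ≤ ε := by
    have h1 := smoothedDualFun_le_dualFun (ν := ν) hT hne hη₁.le η₂ z
    have h2 := dualFun_sub_le_smoothedDualFun (ν := ν) hT hne hη₁.le η₂ z₀
    have h3 := hx z₀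
    have h4 := hnorm z₀ hz₀
    have h5 : 0 ≤ η₂ / 2 * ‖z‖ ^ 2 := by positivity
    rw [hη₁D] at h1
    linarith
  have hnonneg : dualFun ν T z ≤ dualFun ν T z₀ := by
    rw [← hopt]
    exact dualFun_le_relEntropy hT (relEntropy_gibbs_ne_top ν z₀) hmem z
  refine ⟨hdual, ?_, ?_⟩
  -- The errors `ε/4 + (9/10)(6/5)ε` and the dual error `ε` stay below `6ε`, well within the stated
  -- constant.
  · have h1 : ‖p z - moments M (gibbs ν z)‖ * ‖z‖ ≤ 9 / 10 * (ε * δ / C) * ‖z‖ := by gcongr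
    have h2 : 9 / 10 * (ε * δ / C) * ‖z‖ = 9 / 10 * (ε / C) * (δ * ‖z‖) := by ring
    have h3 : 9 / 10 * (ε / C) * (δ * ‖z‖) ≤ 9 / 10 * (ε / C) * (6 / 5 * C) := by gcongr
    have h4 : 9 / 10 * (ε / C) * (6 / 5 * C) = 54 / 50 * ε := by field_simp; norm_num
    have h5 : (1 : ℝ) ≤ √3 := by rw [Real.one_le_sqrt]; norm_num
    have h6 : 6 * ε ≤ 2 * (1 + 2 * √3) * ε := by gcongr; linarith
    rw [hη₁D] at hprimal
    rw [abs_le] at hprimal ⊢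
    constructor <;> linarith [hprimal.1, hprimal.2]
  · have e : 2 * ε * δ / C = 2 * (ε * δ / C) := by ring
    have : 0 < ε * δ / C := by positivity
    rw [e]
    linarith

end Convergence

/-! ### Growth of the iteration count as `ε → 0`. -/

section Complexity

variable {C D δ a : ℝ}

theorem log_div_isBigO {A : ℝ} (hA : 0 < A) (n : ℕ) :
    (fun ε : ℝ => Real.log (A / ε ^ n)) =O[𝓝[>] 0] fun ε => Real.log (1 / ε) := by
  have hlim : Tendsto (fun ε : ℝ => Real.log (1 / ε)) (𝓝[>] 0) atTop := by
    simp only [one_div]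
    exact Real.tendsto_log_atTop.comp tendsto_inv_nhdsGT_zero
  refine IsBigO.of_bound (1 + n) ?_
  filter_upwards [hlim.eventually_ge_atTop |Real.log A|, self_mem_nhdsWithin] with ε h hε
  have hε : 0 < ε := hε
  have h0 : 0 ≤ Real.log (1 / ε) := (abs_nonneg _).trans h
  rw [Real.log_div hA.ne' (by positivity), Real.log_pow, Real.norm_eq_abs, Real.norm_of_nonneg h0]
  have e : Real.log (1 / ε) = -Real.log ε := by rw [one_div, Real.log_inv]
  have e2 : Real.log A - n * Real.log ε = Real.log A + n * Real.log (1 / ε) := by rw [e]; ring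
  rw [e2]
  refine (abs_add_le _ _).trans ?_
  rw [abs_of_nonneg (mul_nonneg n.cast_nonneg h0)]
  linarith

theorem sqrt_condition_isBigO :
    (fun ε : ℝ => √(8 * D * C ^ 2 / (ε ^ 2 * δ ^ 2) + 2 * a ^ 2 * C ^ 2 / (ε * δ ^ 2) + 1))
      =O[𝓝[>] 0] fun ε => 1 / ε := by
  set B := |8 * D * C ^ 2 / δ ^ 2| + |2 * a ^ 2 * C ^ 2 / δ ^ 2| + 1 with hB
  refine IsBigO.of_bound √B ?_
  filter_upwards [Ioo_mem_nhdsGT (one_pos : (0 : ℝ) < 1)] with ε hε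
  have h0 := hε.1
  rw [Real.norm_of_nonneg (Real.sqrt_nonneg _), Real.norm_of_nonneg (by positivity)]
  have e : √B * (1 / ε) = √(B / ε ^ 2) := by
    rw [Real.sqrt_div' _ (by positivity), Real.sqrt_sq h0.le]; ring
  rw [e]
  refine Real.sqrt_le_sqrt ?_
  have hinv : 1 ≤ 1 / ε := (one_le_div h0).2 hε.2.le
  have h1 : 8 * D * C ^ 2 / (ε ^ 2 * δ ^ 2) ≤ |8 * D * C ^ 2 / δ ^ 2| * (1 / ε) ^ 2 := by
    have : 8 * D * C ^ 2 / (ε ^ 2 * δ ^ 2) = 8 * D * C ^ 2 / δ ^ 2 * (1 / ε) ^ 2 := by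
      rw [div_mul_eq_div_div_swap, one_div, inv_pow, div_eq_mul_inv _ (ε ^ 2)]
    rw [this]
    gcongr
    exact le_abs_self _
  have h2 : 2 * a ^ 2 * C ^ 2 / (ε * δ ^ 2) ≤ |2 * a ^ 2 * C ^ 2 / δ ^ 2| * (1 / ε) ^ 2 := by
    have : 2 * a ^ 2 * C ^ 2 / (ε * δ ^ 2) = 2 * a ^ 2 * C ^ 2 / δ ^ 2 * (1 / ε) := by
      rw [div_mul_eq_div_div_swap, one_div, div_eq_mul_inv _ ε]
    rw [this]
    have h3 : 1 / ε ≤ (1 / ε) ^ 2 := le_self_pow₀ hinv two_ne_zero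
    gcongr
    exact le_abs_self _
  have h3 : 1 ≤ (1 / ε) ^ 2 := one_le_pow₀ hinv
  have e2 : B / ε ^ 2 = |8 * D * C ^ 2 / δ ^ 2| * (1 / ε) ^ 2 +
      |2 * a ^ 2 * C ^ 2 / δ ^ 2| * (1 / ε) ^ 2 + (1 / ε) ^ 2 := by
    rw [hB]; ring
  linarith

theorem log_accuracy_ratio_isBigO (hC : 0 < C) :
    (fun ε : ℝ => Real.log (10 * (ε + 2 * C) / ε)) =O[𝓝[>] 0] fun ε => Real.log (1 / ε) := by
  refine IsBigO.trans ?_ (log_div_isBigO (by positivity : 0 < 10 * (1 + 2 * C)) 1)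
  refine IsBigO.of_bound 1 ?_
  filter_upwards [Ioo_mem_nhdsGT (by positivity : (0 : ℝ) < min 1 C)] with ε hε
  have h0 := hε.1
  have h1 : ε < 1 := hε.2.trans_le (min_le_left _ _)
  rw [one_mul, pow_one]
  have hge : 1 ≤ 10 * (ε + 2 * C) / ε := by rw [one_le_div h0]; linarith
  have hle : 10 * (ε + 2 * C) / ε ≤ 10 * (1 + 2 * C) / ε := by gcongr
  rw [Real.norm_of_nonneg (Real.log_nonneg hge), Real.norm_of_nonneg
    (Real.log_nonneg (hge.trans hle))]
  exact Real.log_le_log (by positivity) hle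

end Complexity

section ComplexityBound

variable {C D δ a : ℝ}

/-- The argument lies between a constant over `ε` and a constant over `ε²`. Both sides are needed
since the absolute value of the logarithm is bounded. -/
theorem log_gradient_ratio_isBigO (hC : 0 < C) (hD : 0 < D) (hδ : 0 < δ) :
    (fun ε : ℝ => Real.log (C / (ε * δ * (2 - √3)) *
      √(4 * (4 * D / ε + a ^ 2 + ε * δ ^ 2 / (2 * C ^ 2)) * (C + ε / 2))))
      =O[𝓝[>] 0] fun ε => Real.log (1 / ε) := by
  have hs : 0 < 2 - √3 := by
    have : √3 < 2 := by rw [Real.sqrt_lt' two_pos]; norm_num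
    linarith
  set B := 4 * (4 * D + a ^ 2 + δ ^ 2 / (2 * C ^ 2)) * (C + 1 / 2) with hB
  have hA₁ : 0 < C / (δ * (2 - √3)) * √(16 * D * C) := by positivity
  have hA₂ : 0 < C / (δ * (2 - √3)) * √B := by positivity
  have hO := (log_div_isBigO hA₁ 1).norm_left.add (log_div_isBigO hA₂ 2).norm_left
  refine IsBigO.trans (IsBigO.of_bound 1 ?_) hO
  filter_upwards [Ioo_mem_nhdsGT (one_pos : (0 : ℝ) < 1)] with ε hε
  have h0 := hε.1
  have h1 := hε.2
  have hinv : 1 ≤ 1 / ε := (one_le_div h0).2 h1.le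
  have hlow : 16 * D * C ≤ 4 * (4 * D / ε + a ^ 2 + ε * δ ^ 2 / (2 * C ^ 2)) * (C + ε / 2) := by
    have e : 4 * D ≤ 4 * D / ε := le_div_self (by positivity) h0 h1.le
    have e1 : 0 ≤ a ^ 2 + ε * δ ^ 2 / (2 * C ^ 2) := by positivity
    calc 16 * D * C = 4 * (4 * D) * C := by ring
      _ ≤ _ := by gcongr <;> linarith
  have hup : 4 * (4 * D / ε + a ^ 2 + ε * δ ^ 2 / (2 * C ^ 2)) * (C + ε / 2) ≤ B / ε ^ 2 := by
    have hinv2 : 1 / ε ≤ (1 / ε) ^ 2 := le_self_pow₀ hinv two_ne_zero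
    have e1 : 4 * D / ε ≤ 4 * D * (1 / ε) ^ 2 := by
      rw [div_eq_mul_one_div]; gcongr
    have e2 : a ^ 2 ≤ a ^ 2 * (1 / ε) ^ 2 :=
      le_mul_of_one_le_right (by positivity) (one_le_pow₀ hinv)
    have e3 : ε * δ ^ 2 / (2 * C ^ 2) ≤ δ ^ 2 / (2 * C ^ 2) * (1 / ε) ^ 2 := by
      have : ε * δ ^ 2 / (2 * C ^ 2) = δ ^ 2 / (2 * C ^ 2) * ε := by ring
      rw [this]
      gcongr
      exact h1.le.trans (one_le_pow₀ hinv)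
    calc _ ≤ 4 * (4 * D * (1 / ε) ^ 2 + a ^ 2 * (1 / ε) ^ 2 + δ ^ 2 / (2 * C ^ 2) * (1 / ε) ^ 2) *
          (C + 1 / 2) := by gcongr
      _ = B / ε ^ 2 := by rw [hB]; ring
  set Q := 4 * (4 * D / ε + a ^ 2 + ε * δ ^ 2 / (2 * C ^ 2)) * (C + ε / 2)
  have hX : C / (ε * δ * (2 - √3)) = C / (δ * (2 - √3)) / ε := by
    rw [div_div]; congr 1; ring
  have hle : C / (δ * (2 - √3)) * √(16 * D * C) / ε ^ 1 ≤ C / (ε * δ * (2 - √3)) * √Q := by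
    rw [hX, pow_one, mul_div_right_comm]
    gcongr
  have hge : C / (ε * δ * (2 - √3)) * √Q ≤ C / (δ * (2 - √3)) * √B / ε ^ 2 := by
    have e : C / (δ * (2 - √3)) * √B / ε ^ 2 = C / (δ * (2 - √3)) / ε * √(B / ε ^ 2) := by
      rw [Real.sqrt_div' _ (by positivity), Real.sqrt_sq h0.le]; field_simp
    rw [hX, e]
    gcongr
  have hpos := div_pos hA₁ (pow_pos h0 1)
  have hlog1 := Real.log_le_log hpos hle
  have hlog2 := Real.log_le_log (hpos.trans_le hle) hge
  rw [one_mul, Real.norm_of_nonneg (add_nonneg (norm_nonneg _) (norm_nonneg _))]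
  simp only [Real.norm_eq_abs]
  rw [abs_le]
  constructor
  · linarith [neg_abs_le (Real.log (C / (δ * (2 - √3)) * √(16 * D * C) / ε ^ 1)),
      abs_nonneg (Real.log (C / (δ * (2 - √3)) * √B / ε ^ 2))]
  · linarith [le_abs_self (Real.log (C / (δ * (2 - √3)) * √B / ε ^ 2)),
      abs_nonneg (Real.log (C / (δ * (2 - √3)) * √(16 * D * C) / ε ^ 1))]

theorem iterations_isBigO (hC : 0 < C) (hD : 0 < D) (hδ : 0 < δ) :
    (fun ε : ℝ => (iterations C D δ a ε : ℝ))
      =O[𝓝[>] 0] fun ε : ℝ => 1 / ε * Real.log (1 / ε) := by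
  have h₁ : (fun ε => N₁ C D δ a ε) =O[𝓝[>] 0] fun ε : ℝ => 1 / ε * Real.log (1 / ε) :=
    (sqrt_condition_isBigO.const_mul_left 2).mul (log_accuracy_ratio_isBigO hC)
  have h₂ : (fun ε => N₂ C D δ a ε) =O[𝓝[>] 0] fun ε : ℝ => 1 / ε * Real.log (1 / ε) :=
    (sqrt_condition_isBigO.const_mul_left 2).mul (log_gradient_ratio_isBigO hC hD hδ)
  -- This absorbs the unit lost in rounding up.
  have h₃ : (fun _ : ℝ => (1 : ℝ)) =O[𝓝[>] 0] fun ε : ℝ => 1 / ε * Real.log (1 / ε) := by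
    have hlim : Tendsto (fun ε : ℝ => 1 / ε * Real.log (1 / ε)) (𝓝[>] 0) atTop := by
      simp only [one_div]
      exact tendsto_inv_nhdsGT_zero.atTop_mul_atTop₀
        (Real.tendsto_log_atTop.comp tendsto_inv_nhdsGT_zero)
    refine IsBigO.of_bound 1 ?_
    filter_upwards [hlim.eventually_ge_atTop 1] with ε h
    rw [norm_one, one_mul]
    exact h.trans (le_abs_self _)
  refine IsBigO.trans (IsBigO.of_bound 1 (Eventually.of_forall fun ε => ?_))
    ((h₁.norm_left.add h₂.norm_left).add h₃)
  have hpos : 0 ≤ ‖N₁ C D δ a ε‖ + ‖N₂ C D δ a ε‖ := by positivity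
  have hmax : max (N₁ C D δ a ε) (N₂ C D δ a ε) ≤ ‖N₁ C D δ a ε‖ + ‖N₂ C D δ a ε‖ :=
    max_le ((le_abs_self _).trans (le_add_of_nonneg_right (norm_nonneg _)))
      ((le_abs_self _).trans (le_add_of_nonneg_left (norm_nonneg _)))
  rw [one_mul, Real.norm_of_nonneg (Nat.cast_nonneg _), Real.norm_of_nonneg (by linarith)]
  refine le_trans ?_ (Nat.ceil_lt_add_one hpos).le
  exact_mod_cast Nat.ceil_mono hmax

end ComplexityBound

end MaxEnt

theorem theorem1 {K : Set ℝ} (hK : IsCompact K) {M : ℕ} (ν : ProbabilityMeasure K)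
    (y : Fin M → ℝ) (U : Fin M → Set ℝ)
    (hU : ∀ i, IsCompact (U i) ∧ Convex ℝ (U i) ∧ (0 : ℝ) ∈ U i)
    (μ₀ : ProbabilityMeasure K)
    (T : Set (EuclideanSpace ℝ (Fin M))) (hT : T = MaxEnt.uncertaintySet y U)
    (hfeas : MaxEnt.moments M (μ₀ : Measure K) ∈ T)
    (δ : ℝ) (hδ : δ = MaxEnt.slaterMargin (μ₀ : Measure K) T) (hδpos : 0 < δ)
    (hfin : MaxEnt.relEntropy (μ₀ : Measure K) (ν : Measure K) ≠ ⊤) (hne : μ₀ ≠ ν)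
    (C : ℝ) (hC : C = (MaxEnt.relEntropy (μ₀ : Measure K) (ν : Measure K)).toReal)
    (D : ℝ) (hD : D = MaxEnt.proxBound T) :
    -- the optimal value is finite and attained
    MaxEnt.optimalValue (ν : Measure K) T ≠ ⊤ ∧
    (∃ μ : ProbabilityMeasure K, MaxEnt.moments M (μ : Measure K) ∈ T ∧
      MaxEnt.relEntropy (μ : Measure K) (ν : Measure K) = MaxEnt.optimalValue (ν : Measure K) T) ∧
    (∀ ε : ℝ, 0 < ε →
      let J : ℝ := (MaxEnt.optimalValue (ν : Measure K) T).toReal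
      let η₁ : ℝ := MaxEnt.eta₁ D ε
      let η₂ : ℝ := MaxEnt.eta₂ C δ ε
      let Fη : EuclideanSpace ℝ (Fin M) → ℝ := MaxEnt.smoothedDualFun (ν : Measure K) T η₁ η₂
      let k : ℕ := MaxEnt.iterations C D δ (MaxEnt.opNorm K M) ε
      let z : EuclideanSpace ℝ (Fin M) :=
        (MaxEnt.fastGradient Fη (MaxEnt.lipConst K M η₁ η₂) η₂ k).1
      let μ : Measure K := MaxEnt.gibbs (ν : Measure K) z
      -- the gradient steps and the Gibbs measure are meaningful
      Differentiable ℝ Fη ∧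
      IsProbabilityMeasure μ ∧
      MaxEnt.relEntropy μ (ν : Measure K) ≠ ⊤ ∧
      -- dual optimality
      0 ≤ J - MaxEnt.dualFun (ν : Measure K) T z ∧
      J - MaxEnt.dualFun (ν : Measure K) T z ≤ ε ∧
      -- primal optimality
      |(MaxEnt.relEntropy μ (ν : Measure K)).toReal - J| ≤ 2 * (1 + 2 * √3) * ε ∧
      -- primal feasibility
      Metric.infDist (MaxEnt.moments M μ) T ≤ 2 * ε * δ / C) ∧
    -- the number of iterations is `O((1/ε) log (1/ε))` as `ε → 0`
    (fun ε : ℝ => (MaxEnt.iterations C D δ (MaxEnt.opNorm K M) ε : ℝ))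
      =O[𝓝[>] 0] (fun ε : ℝ => 1 / ε * Real.log (1 / ε)) := by
  have hCompact : IsCompact T := hT ▸ MaxEnt.isCompact_uncertaintySet fun i => (hU i).1
  have hConvex : Convex ℝ T := hT ▸ MaxEnt.convex_uncertaintySet fun i => (hU i).2.1
  have : CompactSpace K := isCompact_iff_compactSpace.1 hK
  have hball := MaxEnt.closedBall_subset_of_infDist_compl hCompact.isClosed hδ hδpos
  have hDpos : 0 < D := hD ▸ MaxEnt.proxBound_pos hCompact hδ hδpos
  have hCpos : 0 < C := hC ▸ MaxEnt.relEntropy_toReal_pos hfin hne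
  obtain ⟨z₀, hmem, hopt, hnorm⟩ := MaxEnt.exists_dual_optimal hCompact hConvex hfin hδpos hball
  have htop := MaxEnt.relEntropy_gibbs_ne_top (ν : Measure K) z₀
  have hmin : MaxEnt.relEntropy (MaxEnt.gibbs (ν : Measure K) z₀) (ν : Measure K) =
      MaxEnt.optimalValue (ν : Measure K) T := by
    refine le_antisymm (le_iInf₂ fun μ hμ => ?_)
      (iInf₂_le (⟨MaxEnt.gibbs (ν : Measure K) z₀, inferInstance⟩ : ProbabilityMeasure K) hmem)
    -- Competitors of infinite entropy are trivial; the others are bounded below by weak duality at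
    -- `z₀`.
    by_cases hμtop : MaxEnt.relEntropy (μ : Measure K) (ν : Measure K) = ⊤
    · rw [hμtop]; exact le_top
    · rw [← ENNReal.toReal_le_toReal htop hμtop, hopt]
      exact MaxEnt.dualFun_le_relEntropy hCompact hμtop hμ z₀
  refine ⟨hmin ▸ htop, ⟨⟨MaxEnt.gibbs (ν : Measure K) z₀, inferInstance⟩, hmem, hmin⟩, ?_,
    MaxEnt.iterations_isBigO hCpos hDpos hδpos⟩
  intro ε hε J η₁ η₂ Fη k z μ
  have hJ : J = MaxEnt.dualFun (ν : Measure K) T z₀ := by rw [← hopt, hmin]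
  obtain ⟨h₁, h₂, h₃⟩ := MaxEnt.approximate_solution hCompact hConvex hfin hδpos hball hC hCpos hD
    hDpos hε (hnorm.trans_eq hC.symm) (k := k) rfl (z := z) rfl hmem hopt
  have hη₁ : 0 < η₁ := div_pos hε (by positivity)
  refine ⟨MaxEnt.differentiable_smoothedDualFun hCompact hConvex ⟨_, hfeas⟩ hη₁ η₂, inferInstance,
    MaxEnt.relEntropy_gibbs_ne_top (ν : Measure K) z, ?_, ?_, ?_, h₃⟩
  · rw [hJ, ← hopt, sub_nonneg]
    exact MaxEnt.dualFun_le_relEntropy hCompact htop hmem z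
  · rw [hJ]; exact h₁
  · rw [hJ]; exact h₂
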